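/- **Setting.** Let $\mathcal{X}$ be a finite alphabet with $|\mathcal{X}|\ge 2$, let $M\ge 2$, and let $\mathcal{P}(\mathcal{X})$ be the set of probability distributions on $\mathcal{X}$. One observes $M$ sequences of symbols of $\mathcal{X}$, one symbol of each sequence per time step; $\mathbf{x}^k$ denotes the first $k$ symbols of all $M$ sequences. For $P_\mathrm{N},P_\mathrm{A}\in\mathcal{P}(\mathcal{X})$ and $i\in[M]=\{1,\dots,M\}$, let $\mathbb{P}_i$ (with expectation $\mathbb{E}_i$) be the law under which all symbols are independent, those of the $i$-th sequence (the outlier) have law $P_\mathrm{A}$, and those of all other sequences have law $P_\mathrm{N}$. A sequential test $\Phi=(\tau,\phi)$ consists of a (possibly infinite) stopping time $\tau$ with respect to the filtration generated by the observations and a decision rule $\phi$ that maps $\mathbf{x}^\tau$ to an index in $[M]$. For $\beta\in(0,1)$, the test satisfies the *error probability universality constraint* at level $\beta$ if $$\max_{i\in[M]}\mathbb{P}_i\{\tau<\infty,\ \phi(\mathbf{X}^\tau)\ne i\}\le\beta\qquad\text{for all }(P_\mathrm{N},P_\mathrm{A})\in\mathcal{P}(\mathcal{X})^2 .$$ The misclassification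 exponent of a family of tests $\Phi=(\Phi_\beta)_{\beta\in(0,1)}$, $\Phi_\beta=(\tau_\beta,\phi_\beta)$, is $$E_i(\Phi|P_\mathrm{N},P_\mathrm{A}):=\liminf_{\beta\downarrow 0}\frac{-\log\beta}{\mathbb{E}_i[\tau_\beta]}\in[0,\infty]$$ (the quotient is $0$ where $\mathbb{E}_i[\tau_\beta]=\infty$). With $D$ the Kullback–Leibler divergence, for $\alpha\ge 0$ put $$\mathrm{GJS}(P,Q,\alpha):=\alpha D\Big(P\Big\|\tfrac{\alpha P+Q}{1+\alpha}\Big)+D\Big(Q\Big\|\tfrac{\alpha P+Q}{1+\alpha}\Big),$$ where the first term is read as $0$ when $\alpha=0$. **The threshold test** $\Phi^{\mathrm{EP}}_\beta$. For $k\ge1$ and $l\in[M]$, let $\hat T_j$ be the empirical distribution of the first $k$ symbols of the $j$-th sequence, and let $$\mathrm{S}_l(\mathbf{x}^k):=\sum_{j\ne l}D\Big(\hat T_j\Big\|\frac{1}{M-1}\sum_{t\ne l}\hat T_t\Big),\qquad g(\beta,k):=\frac{-\log(\beta(|\mathcal{X}|-1))}{k}+\frac{(M+1)|\mathcal{X}|\log(k+1)}{k},$$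 and $\Psi(\mathbf{x}^k):=\{l\in[M]:\mathrm{S}_l(\mathbf{x}^k)>g(\beta,k)\}$. The test stops at the first $k\ge1$ with $|\Psi(\mathbf{x}^k)|\ge M-1$ ($\tau=\infty$ if there is none) and declares the index $i$ with $\Psi(\mathbf{x}^\tau)=[M]\setminus\{i\}$; if $\Psi(\mathbf{x}^\tau)=[M]$, it declares an arbitrary index, chosen by any fixed rule depending on $\beta$ and $\mathbf{x}^\tau$. **Theorem.** 1. For every $\beta\in(0,1)$, the test $\Phi^{\mathrm{EP}}_\beta$ satisfies the error probability universality constraint at level $\beta$. 2. For all $P_\mathrm{N},P_\mathrm{A}\in\mathcal{P}(\mathcal{X})$ with full support and every $i\in[M]$, $$E_i(\Phi^{\mathrm{EP}}|P_\mathrm{N},P_\mathrm{A})\ge\mathrm{GJS}(P_\mathrm{N},P_\mathrm{A},M-2).$$ 3. Conversely, for every family $\Phi=(\Phi_\beta)_{\beta\in(0,1)}$ of sequential tests such that $\Phi_\beta$ satisfies the error probability universality constraint at level $\beta$ for every $\beta\in(0,1)$, for all $P_\mathrm{N},P_\mathrm{A}\in\mathcal{P}(\mathcal{X})$ and every $i\in[M]$,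 $$E_i(\Phi|P_\mathrm{N},P_\mathrm{A})\le\mathrm{GJS}(P_\mathrm{N},P_\mathrm{A},M-2).$$ Hence, for fully supported $P_\mathrm{N},P_\mathrm{A}$, the exponent of $\Phi^{\mathrm{EP}}$ is exactly $\mathrm{GJS}(P_\mathrm{N},P_\mathrm{A},M-2)$, and it is optimal. -/

import Mathlib

open MeasureTheory ProbabilityTheory InformationTheory Filter Topology Set
open scoped ENNReal

namespace OutlierTest

/-- A realization of the `M` infinite observed sequences: `ω t j` is the symbol that the `j`-th
sequence shows at time `t + 1`. -/
abbrev Path (M : ℕ) (X : Type*) := ℕ → Fin M → X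

/-- The first `n` symbols of all `M` sequences. -/
def samples {M : ℕ} {X : Type*} (n : ℕ) (ω : Path M X) : Fin n → Fin M → X := fun t => ω t

/-- `ℱ n` is the σ-algebra generated by the first `n` symbols of all `M` sequences. -/
def obsFiltration (M : ℕ) (X : Type*) [MeasurableSpace X] :
    Filtration ℕ (inferInstance : MeasurableSpace (Path M X)) where
  seq n := MeasurableSpace.comap (samples n) inferInstance
  mono' := by
    intro m n hmn
    have h : (samples m : Path M X → _) =
        (fun (y : Fin n → Fin M → X) (t : Fin m) => y (Fin.castLE hmn t)) ∘ samples n := rfl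
    dsimp only
    rw [h, ← MeasurableSpace.comap_comp]
    apply MeasurableSpace.comap_mono
    apply Measurable.comap_le
    fun_prop
  le' := by
    intro n
    apply Measurable.comap_le
    unfold samples
    fun_prop

/-- A sequential test: a stopping time with respect to the observations, possibly infinite, and a
decision rule, which maps the symbols seen up to the stopping time to the index of the sequence
that is declared to be the outlier. -/
structure SeqTest (M : ℕ) (X : Type*) [MeasurableSpace X] where
  /-- the stopping time -/
  τ : Path M X → ℕ∞
  isStoppingTime : IsStoppingTime (obsFiltration M X) τ
  /-- the decision rule -/
  φ : (k : ℕ) → (Fin k → Fin M → X) → Fin M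

section

variable {M : ℕ} {X : Type*} [MeasurableSpace X]

/-- The law of the observations when sequence `i` is the outlier: all symbols are independent,
those of sequence `i` have law `PA` and those of the other sequences have law `PN`. -/
noncomputable def hypLaw (PN PA : ProbabilityMeasure X) (i : Fin M) : Measure (Path M X) :=
  Measure.infinitePi fun _ : ℕ =>
    Measure.pi fun j : Fin M => ((if j = i then PA else PN : ProbabilityMeasure X) : Measure X)

/-- The misclassification probability: the test stops and declares a sequence other than `i`. -/
noncomputable def misclassProb (Φ : SeqTest M X) (PN PA : ProbabilityMeasure X) (i : Fin M) :
    ℝ≥0∞ :=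
  hypLaw PN PA i {ω | ∃ k : ℕ, Φ.τ ω = k ∧ Φ.φ k (samples k ω) ≠ i}

/-- The error probability universality constraint at level `β`. -/
def ErrorProbConstraint (Φ : SeqTest M X) (β : ℝ) : Prop :=
  ∀ (PN PA : ProbabilityMeasure X) (i : Fin M), misclassProb Φ PN PA i ≤ ENNReal.ofReal β

/-- The expected stopping time when sequence `i` is the outlier. -/
noncomputable def expectedTime (Φ : SeqTest M X) (PN PA : ProbabilityMeasure X) (i : Fin M) :
    ℝ≥0∞ :=
  ∫⁻ ω, (Φ.τ ω : ℝ≥0∞) ∂(hypLaw PN PA i)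

/-- The misclassification exponent of a family of tests, indexed by the level `β`. -/
noncomputable def misclassExponent (Φ : ℝ → SeqTest M X) (PN PA : ProbabilityMeasure X)
    (i : Fin M) : ℝ≥0∞ :=
  liminf (fun β : ℝ => ENNReal.ofReal (-Real.log β) / expectedTime (Φ β) PN PA i) (𝓝[>] 0)

/-- The generalized Jensen-Shannon divergence
`α D(P ‖ (αP + Q)/(1 + α)) + D(Q ‖ (αP + Q)/(1 + α))`. -/
noncomputable def GJS (P Q : Measure X) (α : ℝ≥0∞) : ℝ≥0∞ :=
  α * klDiv P ((1 + α)⁻¹ • (α • P + Q)) + klDiv Q ((1 + α)⁻¹ • (α • P + Q))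

/-- The divergence of all the `Q j`, `j ≠ i`, from their average. -/
noncomputable def G (i : Fin M) (Q : Fin M → Measure X) : ℝ≥0∞ :=
  ∑ j ∈ Finset.univ.erase i,
    klDiv (Q j) (((M - 1 : ℕ) : ℝ≥0∞)⁻¹ • ∑ l ∈ Finset.univ.erase i, Q l)

/-- The type (empirical distribution) of the `j`-th sequence, for `k ≥ 1`. -/
noncomputable def empType {k : ℕ} (x : Fin k → Fin M → X) (j : Fin M) : Measure X :=
  (k : ℝ≥0∞)⁻¹ • ∑ t : Fin k, Measure.dirac (x t j)

/-- The scoring function of index `l`. -/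
noncomputable def score {k : ℕ} (l : Fin M) (x : Fin k → Fin M → X) : ℝ≥0∞ :=
  G l (empType x)

/-- The threshold, for `M` sequences over an alphabet of `A` symbols. -/
noncomputable def threshold (M A : ℕ) (β : ℝ) (k : ℕ) : ℝ :=
  -Real.log (β * ((A : ℝ) - 1)) / k + ((M : ℝ) + 1) * A * Real.log ((k : ℝ) + 1) / k

open Classical in
/-- The set of indices whose score exceeds the threshold. -/
noncomputable def Psi [Fintype X] (β : ℝ) {k : ℕ} (x : Fin k → Fin M → X) : Finset (Fin M) :=
  Finset.univ.filter fun l =>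
    ((threshold M (Fintype.card X) β k : ℝ) : EReal) < ((score l x : ℝ≥0∞) : EReal)

/-- The stopping time of the threshold test: the first `k ≥ 1` such that at least `M - 1` scores
exceed the threshold (`⊤` if there is none). -/
noncomputable def epTime [Fintype X] (β : ℝ) (ω : Path M X) : ℕ∞ :=
  ⨅ (k : ℕ) (_ : 1 ≤ k ∧ M - 1 ≤ (Psi β (samples k ω)).card), (k : ℕ∞)

open Classical in
/-- The decision rule of the threshold test: declare the unique index outside `Psi`. If `Psi`
contains all indices, any index may be declared; `d` says which. -/
noncomputable def epDecision [Fintype X] (β : ℝ) (d : (k : ℕ) → (Fin k → Fin M → X) → Fin M)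
    (k : ℕ) (x : Fin k → Fin M → X) : Fin M :=
  if h : ∃ i, Psi β x = Finset.univ.erase i then h.choose else d k x

theorem epTime_le_iff [Fintype X] (β : ℝ) (ω : Path M X) (n : ℕ) :
    epTime β ω ≤ n ↔ ∃ k ≤ n, 1 ≤ k ∧ M - 1 ≤ (Psi β (samples k ω)).card := by
  constructor
  · intro h
    by_contra! hc
    have h2 : ((n + 1 : ℕ) : ℕ∞) ≤ epTime β ω := by
      refine le_iInf₂ fun k hk => ?_
      by_cases hkn : k ≤ n
      · exact absurd hk.2 (not_le.mpr (hc k hkn hk.1))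
      · exact_mod_cast Nat.lt_of_not_le hkn
    have h3 := h2.trans h
    have h4 : n + 1 ≤ n := by exact_mod_cast h3
    omega
  · rintro ⟨k, hkn, hk⟩
    exact (iInf₂_le k hk).trans (by exact_mod_cast hkn)

/-- The threshold test at level `β`. -/
noncomputable def epTest [Fintype X] [MeasurableSingletonClass X] (β : ℝ)
    (d : (k : ℕ) → (Fin k → Fin M → X) → Fin M) : SeqTest M X where
  τ := epTime β
  isStoppingTime := by
    intro n
    have h : {ω : Path M X | epTime β ω ≤ (n : ℕ∞)} =
        samples n ⁻¹' {y | ∃ k, ∃ hk : k ≤ n, 1 ≤ k ∧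
          M - 1 ≤ (Psi β (fun t : Fin k => y (Fin.castLE hk t))).card} := by
      ext ω
      simp only [mem_ofPred_eq, mem_preimage, epTime_le_iff]
      constructor
      · rintro ⟨k, hk, h⟩
        exact ⟨k, hk, h⟩
      · rintro ⟨k, hk, h⟩
        exact ⟨k, hk, h⟩
    change MeasurableSet[obsFiltration M X n] {ω : Path M X | epTime β ω ≤ (n : ℕ∞)}
    rw [h]
    exact ⟨_, (Set.toFinite _).measurableSet, rfl⟩
  φ := epDecision β d

end

end OutlierTest

open OutlierTest

namespace OutlierTest

/-! ### Divergences on a finite alphabet -/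

section Divergence

/-! Write `D` for `GJS PN PA (M - 2)`. Leaving out a sequence `l` other than the outlier `i` leaves
`M - 2` laws `PN` and one `PA`, whose total divergence from their average is `D`. This is the mean
of the one-step log-likelihood ratio `llrSum`, and all three bounds rest on that ratio.

Converse: compare the true law with the hypothesis that `l` is the outlier, with law `PN`, while all
other sequences follow the average. Sequence `l` has the same law under both, so the log-likelihood
ratio grows at rate `D` per step. Declaring `i` is an error under the alternative, hence has
probability at most `β` there; by change of measure its true probability up to time `n` is at most
about `exp (n * D) * β`. So stopping much before `-log β / D` is unlikely (`exists_hypLaw_time_le`,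
`misclassExponent_le`).

Error probability: a wrong declaration forces the score of the true outlier `i` above the threshold.
The other sequences all have law `PN`, and their divergences from `PN` add up to at least the score,
so their likelihood is at most `exp (-k * threshold)` times that under their own types
(`prod_le_of_lt_score`). The latter likelihoods sum to at most the number of types, and the
threshold makes the resulting bounds summable over `k`, with sum at most `β`.

Expected time: the score is convex in the types and so lies above its tangent plane at the true laws
(`sum_llrSum_le_empType`). For `l ≠ i` that plane is an empirical mean with expectation `D`, to
which Hoeffding's inequality applies. Once `k` exceeds `-log β / a` with `a < D`, up to a constant,
not having stopped has exponentially small probability; hence the expected time is at most `-log β /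
a` plus a constant free of `β`. -/

theorem sum_erase_ite {M : ℕ} {A : Type*} [AddCommMonoid A] {i l : Fin M} (hl : l ≠ i)
    (a b : A) :
    ∑ j ∈ Finset.univ.erase l, (if j = i then a else b) = (M - 2) • b + a := by
  have hi : i ∈ Finset.univ.erase l := by simp [hl.symm]
  rw [← Finset.add_sum_erase _ _ hi, if_pos rfl, add_comm]
  congr 1
  rw [Finset.sum_congr rfl fun j hj => if_neg (Finset.ne_of_mem_erase hj), Finset.sum_const,
    Finset.card_erase_of_mem hi, Finset.card_erase_of_mem (Finset.mem_univ l), Finset.card_univ,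
    Fintype.card_fin, Nat.sub_sub]

variable {X : Type*} [MeasurableSpace X] {M : ℕ}

/-- The laws of the sequences when sequence `i` is the outlier. -/
noncomputable def seqLaw (PN PA : ProbabilityMeasure X) (i j : Fin M) : Measure X :=
  ((if j = i then PA else PN : ProbabilityMeasure X) : Measure X)

instance (PN PA : ProbabilityMeasure X) (i j : Fin M) :
    IsProbabilityMeasure (seqLaw PN PA i j) := by
  unfold seqLaw; infer_instance

/-- The average of the laws `P j`, `j ≠ l`. -/
noncomputable def avgLaw (l : Fin M) (P : Fin M → Measure X) : Measure X :=
  ((M - 1 : ℕ) : ℝ≥0∞)⁻¹ • ∑ j ∈ Finset.univ.erase l, P j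

theorem isProbabilityMeasure_avgLaw (hM : 2 ≤ M) (l : Fin M) (P : Fin M → Measure X)
    [∀ j, IsProbabilityMeasure (P j)] : IsProbabilityMeasure (avgLaw l P) := by
  constructor
  have h0 : ((M - 1 : ℕ) : ℝ≥0∞) ≠ 0 := by
    simp only [ne_eq, Nat.cast_eq_zero]; omega
  simp only [avgLaw, Measure.smul_apply, Measure.finsetSum_apply, measure_univ, Finset.sum_const,
    Finset.card_erase_of_mem (Finset.mem_univ l), Finset.card_univ, Fintype.card_fin, smul_eq_mul,
    nsmul_eq_mul, mul_one]
  exact ENNReal.inv_mul_cancel h0 (ENNReal.natCast_ne_top _)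

theorem avgLaw_real (l : Fin M) (P : Fin M → Measure X) [∀ j, IsProbabilityMeasure (P j)]
    (s : Set X) :
    (avgLaw l P).real s = ((M - 1 : ℕ) : ℝ)⁻¹ * ∑ j ∈ Finset.univ.erase l, (P j).real s := by
  simp only [avgLaw, Measure.real, Measure.smul_apply, Measure.finsetSum_apply, smul_eq_mul,
    ENNReal.toReal_mul, ENNReal.toReal_inv, ENNReal.toReal_natCast]
  rw [ENNReal.toReal_sum fun j _ => measure_ne_top _ _]

theorem absolutelyContinuous_avgLaw {l j : Fin M} (hj : j ≠ l) (P : Fin M → Measure X) :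
    P j ≪ avgLaw l P := by
  intro s hs
  simp only [avgLaw, Measure.smul_apply, Measure.finsetSum_apply, smul_eq_mul, mul_eq_zero,
    ENNReal.inv_eq_zero, ENNReal.natCast_ne_top, false_or, Finset.sum_eq_zero_iff] at hs
  exact hs j (by simp [hj])

/-- Without `l` there remain `M - 2` copies of `PN` and one `PA`; their average is the mixture in
`GJS` with weight `M - 2`. -/
theorem G_seqLaw (hM : 2 ≤ M) (PN PA : ProbabilityMeasure X) {i l : Fin M} (hl : l ≠ i) :
    G l (seqLaw PN PA i) = GJS (PN : Measure X) (PA : Measure X) ((M - 2 : ℕ) : ℝ≥0∞) := by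
  have e : ∀ j, seqLaw PN PA i j = if j = i then (PA : Measure X) else (PN : Measure X) := by
    intro j; unfold seqLaw; split_ifs <;> rfl
  have e1 : (1 : ℝ≥0∞) + ((M - 2 : ℕ) : ℝ≥0∞) = ((M - 1 : ℕ) : ℝ≥0∞) := by
    norm_cast; omega
  have e2 : ((M - 2 : ℕ) : ℝ≥0∞) • (PN : Measure X) = (M - 2) • (PN : Measure X) :=
    Nat.cast_smul_eq_nsmul _ _ _
  unfold G GJS
  simp only [e, e1, e2, sum_erase_ite hl]
  rw [← nsmul_eq_mul]
  refine Eq.trans (Finset.sum_congr rfl fun j _ => ?_) (sum_erase_ite hl _ _)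
  split_ifs <;> rfl

variable [Fintype X] [MeasurableSingletonClass X]

theorem llr_ae_eq_of_finite (μ ν : Measure X) [IsProbabilityMeasure μ] [IsProbabilityMeasure ν]
    (h : μ ≪ ν) : llr μ ν =ᵐ[μ] fun x => Real.log (μ.real {x} / ν.real {x}) := by
  have hd : μ = ν.withDensity fun x => μ {x} / ν {x} := by
    refine Measure.ext_of_singleton fun x => ?_
    rw [withDensity_apply _ (measurableSet_singleton x), lintegral_singleton]
    by_cases hx : ν {x} = 0
    · rw [hx, h hx, mul_zero]
    · rw [ENNReal.div_mul_cancel hx (measure_ne_top _ _)]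
  have hr : μ.rnDeriv ν =ᵐ[ν] fun x => μ {x} / ν {x} := by
    conv_lhs => rw [hd]
    exact Measure.rnDeriv_withDensity ν (measurable_of_finite _)
  filter_upwards [h.ae_le hr] with x hx
  rw [llr, hx, ENNReal.toReal_div, Measure.real, Measure.real]

theorem klDiv_eq_ofReal_integral (μ ν : Measure X) [IsProbabilityMeasure μ]
    [IsProbabilityMeasure ν] (h : μ ≪ ν) :
    klDiv μ ν = ENNReal.ofReal (∫ x, Real.log (μ.real {x} / ν.real {x}) ∂μ) := by
  have hae := llr_ae_eq_of_finite μ ν h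
  have hint : Integrable (llr μ ν) μ := Integrable.of_finite
  rw [klDiv_of_ac_of_integrable h hint, integral_congr_ae hae]
  simp

theorem integral_log_div_nonneg (μ ν : Measure X) [IsProbabilityMeasure μ]
    [IsProbabilityMeasure ν] (h : μ ≪ ν) :
    0 ≤ ∫ x, Real.log (μ.real {x} / ν.real {x}) ∂μ := by
  have := integral_llr_add_sub_measure_univ_nonneg h (Integrable.of_finite)
  rw [integral_congr_ae (llr_ae_eq_of_finite μ ν h)] at this
  simpa using this

/-- The log-likelihood ratio, at one time step, of the laws `P j`, `j ≠ l`, against their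
average. -/
noncomputable def llrSum (l : Fin M) (P : Fin M → Measure X) (y : Fin M → X) : ℝ :=
  ∑ j ∈ Finset.univ.erase l, Real.log ((P j).real {y j} / (avgLaw l P).real {y j})

theorem G_eq_ofReal_sum (hM : 2 ≤ M) (l : Fin M) (P : Fin M → Measure X)
    [∀ j, IsProbabilityMeasure (P j)] :
    G l P = ENNReal.ofReal (∑ j ∈ Finset.univ.erase l,
      ∫ x, Real.log ((P j).real {x} / (avgLaw l P).real {x}) ∂(P j)) := by
  have := isProbabilityMeasure_avgLaw hM l P
  rw [ENNReal.ofReal_sum_of_nonneg]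
  · refine Finset.sum_congr rfl fun j hj => ?_
    exact klDiv_eq_ofReal_integral (P j) (avgLaw l P) (absolutelyContinuous_avgLaw (Finset.ne_of_mem_erase hj) P)
  · intro j hj
    exact integral_log_div_nonneg _ _ (absolutelyContinuous_avgLaw (Finset.ne_of_mem_erase hj) P)

theorem integral_llrSum (l : Fin M) (P : Fin M → Measure X)
    [∀ j, IsProbabilityMeasure (P j)] :
    ∫ y, llrSum l P y ∂(Measure.pi P) = ∑ j ∈ Finset.univ.erase l,
      ∫ x, Real.log ((P j).real {x} / (avgLaw l P).real {x}) ∂(P j) := by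
  unfold llrSum
  rw [integral_finsetSum _ fun j _ => Integrable.of_finite]
  refine Finset.sum_congr rfl fun j _ => ?_
  exact integral_comp_eval (μ := P) (i := j)
    (f := fun x => Real.log ((P j).real {x} / (avgLaw l P).real {x}))
    (measurable_of_finite _).aestronglyMeasurable

theorem integral_llrSum_nonneg (hM : 2 ≤ M) (l : Fin M) (P : Fin M → Measure X)
    [∀ j, IsProbabilityMeasure (P j)] : 0 ≤ ∫ y, llrSum l P y ∂(Measure.pi P) := by
  have := isProbabilityMeasure_avgLaw hM l P
  rw [integral_llrSum]
  refine Finset.sum_nonneg fun j hj => ?_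
  exact integral_log_div_nonneg _ _ (absolutelyContinuous_avgLaw (Finset.ne_of_mem_erase hj) P)

theorem G_eq_ofReal_integral (hM : 2 ≤ M) (l : Fin M) (P : Fin M → Measure X)
    [∀ j, IsProbabilityMeasure (P j)] :
    G l P = ENNReal.ofReal (∫ y, llrSum l P y ∂(Measure.pi P)) := by
  rw [integral_llrSum, G_eq_ofReal_sum hM]

end Divergence

/-! ### Finite samples of an independent sequence -/

section Samples

variable {X : Type*} [MeasurableSpace X] {M : ℕ}

theorem measurable_samples (n : ℕ) : Measurable (samples n : Path M X → _) := by
  unfold samples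
  fun_prop

variable [Fintype X] [MeasurableSingletonClass X]

theorem infinitePi_samples_singleton (ν : Measure (Fin M → X)) [IsProbabilityMeasure ν] {n : ℕ}
    (y : Fin n → Fin M → X) :
    Measure.infinitePi (fun _ : ℕ => ν) (samples n ⁻¹' {y}) = ∏ t, ν {y t} := by
  have h : (samples n ⁻¹' {y} : Set (Path M X)) =
      Set.pi (Finset.range n) fun t => if h : t < n then {y ⟨t, h⟩} else univ := by
    ext ω
    simp only [mem_preimage, mem_singleton_iff, Set.mem_pi, Finset.coe_range, mem_Iio]
    constructor
    · rintro rfl t ht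
      simp [ht, samples]
    · intro hω
      funext t
      simpa [samples] using hω t t.2
  rw [h, Measure.infinitePi_pi _ fun t _ => (Set.toFinite _).measurableSet, Finset.prod_range]
  simp

theorem infinitePi_samples_preimage (ν : Measure (Fin M → X)) [IsProbabilityMeasure ν] {n : ℕ}
    (B : Finset (Fin n → Fin M → X)) :
    Measure.infinitePi (fun _ : ℕ => ν) (samples n ⁻¹' B) = ∑ y ∈ B, ∏ t, ν {y t} := by
  rw [← Measure.map_apply (measurable_samples n) B.measurableSet, ← sum_measure_singleton]
  refine Finset.sum_congr rfl fun y _ => ?_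
  rw [Measure.map_apply (measurable_samples n) (measurableSet_singleton y),
    infinitePi_samples_singleton]

/-- On the event, the likelihood ratio of the sample is at most the product of the `exp (f (y t))`,
hence at most `exp c`. Only an upper bound on the one-step ratio is needed, so symbols of mass zero
do no harm. -/
theorem infinitePi_change_of_measure (ν ν' : Measure (Fin M → X)) [IsProbabilityMeasure ν]
    [IsProbabilityMeasure ν'] (f : (Fin M → X) → ℝ)
    (hf : ∀ y, ν {y} ≤ ENNReal.ofReal (Real.exp (f y)) * ν' {y}) {n : ℕ}
    (B : Set (Fin n → Fin M → X)) (c : ℝ) :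
    Measure.infinitePi (fun _ : ℕ => ν) (samples n ⁻¹' {y | y ∈ B ∧ ∑ t, f (y t) ≤ c}) ≤
      ENNReal.ofReal (Real.exp c) * Measure.infinitePi (fun _ : ℕ => ν') (samples n ⁻¹' B) := by
  classical
  have e1 : {y | y ∈ B ∧ ∑ t, f (y t) ≤ c} =
      ((Finset.univ.filter fun y => y ∈ B ∧ ∑ t, f (y t) ≤ c :
        Finset (Fin n → Fin M → X)) : Set (Fin n → Fin M → X)) := by simp
  have e2 : B = ((Finset.univ.filter fun y => y ∈ B : Finset (Fin n → Fin M → X)) :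
      Set (Fin n → Fin M → X)) := by simp
  rw [e1, infinitePi_samples_preimage]
  conv_rhs => rw [e2, infinitePi_samples_preimage, Finset.mul_sum]
  refine (Finset.sum_le_sum (g := fun y => ENNReal.ofReal (Real.exp c) * ∏ t, ν' {y t})
    fun y hy => ?_).trans (Finset.sum_le_sum_of_subset fun y hy => ?_)
  · have hc := (Finset.mem_filter.mp hy).2.2
    calc ∏ t, ν {y t} ≤ ∏ t, (ENNReal.ofReal (Real.exp (f (y t))) * ν' {y t}) :=
          Finset.prod_le_prod' fun t _ => hf (y t)
      _ = ENNReal.ofReal (Real.exp (∑ t, f (y t))) * ∏ t, ν' {y t} := by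
          rw [Finset.prod_mul_distrib, Real.exp_sum,
            ENNReal.ofReal_prod_of_nonneg fun t _ => (Real.exp_pos _).le]
      _ ≤ _ := by gcongr
  · simp only [Finset.mem_filter, Finset.mem_univ, true_and] at hy ⊢
    exact hy.1

/-- Hoeffding's inequality for the empirical mean of a function of independent symbols. -/
theorem exists_infinitePi_sum_le (ν : Measure (Fin M → X)) [IsProbabilityMeasure ν]
    (f : (Fin M → X) → ℝ) {ε : ℝ} (hε : 0 < ε) :
    ∃ c : ℝ, 0 < c ∧ ∀ n : ℕ, Measure.infinitePi (fun _ : ℕ => ν)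
      {ω | ∑ t : Fin n, f (ω t) ≤ n * (∫ y, f y ∂ν - ε)} ≤
        ENNReal.ofReal (Real.exp (-(c * n))) := by
  -- A bound for `|f|`; the `+ 1` keeps it positive when `f` vanishes. The variance proxy is then `C
  -- ^ 2`.
  set C : ℝ := ∑ y, |f y| + 1 with hC
  have hC0 : 0 < C := by positivity
  have hb : ∀ y, -f y ∈ Set.Icc (-C) C := by
    intro y
    have h1 : |f y| ≤ ∑ y, |f y| :=
      Finset.single_le_sum (f := fun y => |f y|) (fun _ _ => abs_nonneg _) (Finset.mem_univ y)
    rw [Set.mem_Icc, ← abs_le, abs_neg]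
    linarith
  set P := Measure.infinitePi fun _ : ℕ => ν with hP
  set c0 : NNReal := (‖C - -C‖₊ / 2) ^ 2 with hc0
  have hc0' : (c0 : ℝ) = C ^ 2 := by
    rw [hc0]; push_cast
    rw [Real.norm_of_nonneg (by linarith)]; ring
  have hm : ∀ t : ℕ, ∫ ω, -f (ω t) ∂P = -∫ y, f y ∂ν := by
    intro t
    rw [integral_neg]
    congr 1
    have := (measurePreserving_eval_infinitePi (fun _ : ℕ => ν) t).map_eq
    conv_rhs => rw [← this]
    rw [integral_map (measurable_pi_apply t).aemeasurable
      (measurable_of_finite f).aestronglyMeasurable]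
  have hsub : ∀ t : ℕ, HasSubgaussianMGF (fun ω : Path M X => -f (ω t) - -∫ y, f y ∂ν) c0 P := by
    intro t
    have := hasSubgaussianMGF_of_mem_Icc (μ := P) (X := fun ω : Path M X => -f (ω t))
      (a := -C) (b := C) (((measurable_of_finite fun y => -f y).comp
        (measurable_pi_apply t)).aemeasurable) (Eventually.of_forall fun ω => hb (ω t))
    rwa [hm t] at this
  have hind : iIndepFun (fun (t : ℕ) (ω : Path M X) => -f (ω t) - -∫ y, f y ∂ν) P :=
    iIndepFun_infinitePi (P := fun _ : ℕ => ν) (X := fun (_ : ℕ) y => -f y - -∫ y, f y ∂ν)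
      fun _ => measurable_of_finite _
  refine ⟨ε ^ 2 / (2 * C ^ 2), by positivity, fun n => ?_⟩
  have key := HasSubgaussianMGF.measure_sum_range_ge_le_of_iIndepFun hind (c := c0) (n := n)
    (fun t _ => hsub t) (ε := n * ε) (by positivity)
  have hset : {ω : Path M X | ∑ t : Fin n, f (ω t) ≤ n * (∫ y, f y ∂ν - ε)} =
      {ω | n * ε ≤ ∑ t ∈ Finset.range n, (-f (ω t) - -∫ y, f y ∂ν)} := by
    ext ω
    simp only [mem_ofPred_eq, Finset.sum_sub_distrib, Finset.sum_neg_distrib, Finset.sum_const,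
      Finset.card_range, nsmul_eq_mul, Finset.sum_range]
    constructor <;> intro h <;> linarith
  rw [hset, ← ofReal_measureReal]
  refine ENNReal.ofReal_le_ofReal (key.trans (Real.exp_le_exp.mpr (le_of_eq ?_)))
  rw [hc0']
  rcases Nat.eq_zero_or_pos n with rfl | hn
  · simp
  · field_simp

end Samples

/-! ### The converse bound -/

section Converse

variable {X : Type*} [MeasurableSpace X] {M : ℕ}

theorem hypLaw_eq (PN PA : ProbabilityMeasure X) (i : Fin M) :
    hypLaw PN PA i = Measure.infinitePi fun _ : ℕ => Measure.pi (seqLaw PN PA i) := rfl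

instance (PN PA : ProbabilityMeasure X) (i : Fin M) : IsProbabilityMeasure (hypLaw PN PA i) := by
  rw [hypLaw_eq]; infer_instance

theorem measurableSet_time_le (Φ : SeqTest M X) (n : ℕ) : MeasurableSet {ω | Φ.τ ω ≤ n} :=
  (obsFiltration M X).le n _ (Φ.isStoppingTime n)

/-- Markov's inequality; integrality of the stopping time gives the factor `n + 1`, which later
absorbs a floor. -/
theorem mul_le_expectedTime (Φ : SeqTest M X) (PN PA : ProbabilityMeasure X) (i : Fin M) (n : ℕ) :
    ((n + 1 : ℕ) : ℝ≥0∞) * (1 - hypLaw PN PA i {ω | Φ.τ ω ≤ n}) ≤ expectedTime Φ PN PA i := by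
  have hms := measurableSet_time_le Φ n
  rw [← prob_compl_eq_one_sub hms, ← lintegral_indicator_const hms.compl]
  refine lintegral_mono fun ω => ?_
  refine Set.indicator_apply_le' (fun hω => ?_) fun _ => zero_le
  have h : ((n + 1 : ℕ) : ℕ∞) ≤ Φ.τ ω := by
    have : (n : ℕ∞) < Φ.τ ω := not_le.mp hω
    rw [Nat.cast_add, Nat.cast_one]
    exact Order.add_one_le_of_lt this
  have := ENat.toENNReal_le.mpr h
  rwa [ENat.toENNReal_coe] at this

/-- The event is decided by the first `n` symbols, so the change of measure on `n` samples applies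
to it. -/
theorem exists_stopped_decision [Fintype X] [MeasurableSingletonClass X] (Φ : SeqTest M X)
    (i : Fin M) (n : ℕ) :
    ∃ B : Set (Fin n → Fin M → X), samples n ⁻¹' B =
      {ω | ∃ k : ℕ, k ≤ n ∧ Φ.τ ω = k ∧ Φ.φ k (samples k ω) = i} := by
  have h : MeasurableSet[obsFiltration M X n]
      {ω : Path M X | ∃ k : ℕ, k ≤ n ∧ Φ.τ ω = k ∧ Φ.φ k (samples k ω) = i} := by
    have e : {ω : Path M X | ∃ k : ℕ, k ≤ n ∧ Φ.τ ω = k ∧ Φ.φ k (samples k ω) = i} =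
        ⋃ k : ℕ, ⋃ _ : k ≤ n, {ω | Φ.τ ω = k} ∩ samples k ⁻¹' {y | Φ.φ k y = i} := by
      ext ω
      simp only [mem_ofPred_eq, mem_iUnion, mem_inter_iff, mem_preimage, exists_prop]
    rw [e]
    refine MeasurableSet.iUnion fun k => MeasurableSet.iUnion fun hk => ?_
    refine (obsFiltration M X).mono hk _ ?_
    exact MeasurableSet.inter (Φ.isStoppingTime.measurableSet_eq k)
      ⟨_, (Set.toFinite _).measurableSet, rfl⟩
  obtain ⟨B, -, hB⟩ := h
  exact ⟨B, hB⟩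

/-- Sequence `l` has law `PN` on both sides and cancels; each other factor contributes its law over
the average. Equality can fail where some law vanishes, as the real logarithm of `0` is `0`. -/
theorem pi_seqLaw_singleton_le (hM : 2 ≤ M) (PN PA Q : ProbabilityMeasure X) {i l : Fin M}
    (hl : l ≠ i) (hQ : (Q : Measure X) = avgLaw l (seqLaw PN PA i)) (y : Fin M → X) :
    Measure.pi (seqLaw PN PA i) {y} ≤
      ENNReal.ofReal (Real.exp (llrSum l (seqLaw PN PA i) y)) *
        Measure.pi (seqLaw Q PN l) {y} := by
  have := isProbabilityMeasure_avgLaw hM l (seqLaw PN PA i)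
  rw [Measure.pi_singleton, Measure.pi_singleton, llrSum, Real.exp_sum,
    ENNReal.ofReal_prod_of_nonneg fun t _ => (Real.exp_pos _).le,
    ← Finset.mul_prod_erase _ _ (Finset.mem_univ l),
    ← Finset.mul_prod_erase _ (fun j => seqLaw Q PN l j {y j}) (Finset.mem_univ l)]
  have e1 : seqLaw PN PA i l = PN := by simp [seqLaw, hl]
  have e2 : seqLaw Q PN l l = PN := by simp [seqLaw]
  rw [e1, e2, mul_left_comm, ← Finset.prod_mul_distrib]
  refine mul_le_mul_right (Finset.prod_le_prod' fun j hj => ?_) _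
  have hjl := Finset.ne_of_mem_erase hj
  have e3 : seqLaw Q PN l j = avgLaw l (seqLaw PN PA i) := by simp [seqLaw, hjl, hQ]
  rw [e3]
  set μ := seqLaw PN PA i j
  set ν := avgLaw l (seqLaw PN PA i)
  by_cases h0 : μ {y j} = 0
  · simp [h0]
  have h1 : ν {y j} ≠ 0 := fun h => h0 (absolutelyContinuous_avgLaw hjl _ h)
  have h0' : 0 < μ.real {y j} := ENNReal.toReal_pos h0 (measure_ne_top _ _)
  have h1' : 0 < ν.real {y j} := ENNReal.toReal_pos h1 (measure_ne_top _ _)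
  rw [Real.exp_log (by positivity), ← ofReal_measureReal (s := {y j}) (μ := μ),
    ← ofReal_measureReal (s := {y j}) (μ := ν), ← ENNReal.ofReal_mul (by positivity),
    div_mul_cancel₀ _ h1'.ne']

variable [Fintype X] [MeasurableSingletonClass X]

/-- Stopping by time `n` means declaring wrongly, or having an atypically large log-likelihood
ratio, or declaring `i` with ratio at most `exp (n * (D + ε))`. The three terms bound these events.
The constants do not depend on the test or on `β`. -/
theorem exists_hypLaw_time_le (hM : 2 ≤ M) (PN PA : ProbabilityMeasure X) (i : Fin M) {ε : ℝ}
    (hε : 0 < ε) : ∃ D c : ℝ, 0 ≤ D ∧ 0 < c ∧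
      GJS (PN : Measure X) (PA : Measure X) ((M - 2 : ℕ) : ℝ≥0∞) = ENNReal.ofReal D ∧
      ∀ (Φ : SeqTest M X) (β : ℝ), 0 ≤ β → ErrorProbConstraint Φ β → ∀ n : ℕ,
        hypLaw PN PA i {ω | Φ.τ ω ≤ n} ≤
          ENNReal.ofReal (β + Real.exp (-(c * n)) + Real.exp (n * (D + ε)) * β) := by
  have : Nontrivial (Fin M) := Fin.nontrivial_iff_two_le.mpr hM
  obtain ⟨l, hl⟩ := exists_ne i
  set f := llrSum l (seqLaw PN PA i) with hf
  set D := ∫ y, f y ∂(Measure.pi (seqLaw PN PA i)) with hD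
  -- The upper tail of `f` is the lower tail of `-f`.
  obtain ⟨c, hc, hdev⟩ := exists_infinitePi_sum_le (Measure.pi (seqLaw PN PA i))
    (fun y => -f y) hε
  refine ⟨D, c, integral_llrSum_nonneg hM l _, hc, ?_, fun Φ β hβ hΦ n => ?_⟩
  · rw [← G_seqLaw hM PN PA hl, G_eq_ofReal_integral hM]
  set Q : ProbabilityMeasure X := ⟨avgLaw l (seqLaw PN PA i), isProbabilityMeasure_avgLaw hM l _⟩
  obtain ⟨B, hB⟩ := exists_stopped_decision Φ i n
  have hsub : {ω | Φ.τ ω ≤ n} ⊆ ({ω | ∃ k : ℕ, Φ.τ ω = k ∧ Φ.φ k (samples k ω) ≠ i} ∪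
      {ω | ∑ t : Fin n, -f (ω t) ≤ n * (∫ y, -f y ∂(Measure.pi (seqLaw PN PA i)) - ε)}) ∪
      samples n ⁻¹' {y | y ∈ B ∧ ∑ t, f (y t) ≤ n * (D + ε)} := by
    intro ω hω
    obtain ⟨k, hk⟩ := ENat.ne_top_iff_exists.mp (ne_top_of_le_ne_top (ENat.natCast_ne_top n) hω)
    by_cases h1 : Φ.φ k (samples k ω) = i
    · by_cases h2 : ∑ t : Fin n, f (ω t) ≤ n * (D + ε)
      · refine Or.inr ⟨?_, h2⟩
        have : ω ∈ samples n ⁻¹' B := by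
          rw [hB]
          refine ⟨k, ?_, hk.symm, h1⟩
          have h3 : Φ.τ ω ≤ n := hω
          rw [← hk] at h3
          exact_mod_cast h3
        exact this
      · refine Or.inl (Or.inr ?_)
        simp only [mem_ofPred_eq, Finset.sum_neg_distrib, integral_neg]
        rw [← hD]
        linarith
    · exact Or.inl (Or.inl ⟨k, hk.symm, h1⟩)
  have hthird : hypLaw PN PA i (samples n ⁻¹' {y | y ∈ B ∧ ∑ t, f (y t) ≤ n * (D + ε)}) ≤
      ENNReal.ofReal (Real.exp (n * (D + ε))) * ENNReal.ofReal β := by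
    refine (infinitePi_change_of_measure _ (Measure.pi (seqLaw Q PN l)) f
      (pi_seqLaw_singleton_le hM PN PA Q hl rfl) B _).trans ?_
    refine mul_le_mul_right (le_trans (measure_mono ?_) (hΦ Q PN l)) _
    rw [hB]
    rintro ω ⟨k, -, hk, h⟩
    exact ⟨k, hk, by rw [h]; exact hl.symm⟩
  refine (measure_mono hsub).trans ((measure_union_le _ _).trans ?_)
  rw [ENNReal.ofReal_add (by positivity) (by positivity),
    ENNReal.ofReal_add hβ (by positivity), ENNReal.ofReal_mul (by positivity)]
  refine add_le_add ((measure_union_le _ _).trans (add_le_add (hΦ PN PA i) (hdev n))) hthird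

theorem misclassExponent_le (hM : 2 ≤ M) (Φ : ℝ → SeqTest M X)
    (hΦ : ∀ β ∈ Set.Ioo (0 : ℝ) 1, ErrorProbConstraint (Φ β) β) (PN PA : ProbabilityMeasure X)
    (i : Fin M) :
    misclassExponent Φ PN PA i ≤
      GJS (PN : Measure X) (PA : Measure X) ((M - 2 : ℕ) : ℝ≥0∞) := by
  have hlog : Tendsto (fun β : ℝ => -Real.log β) (𝓝[>] 0) atTop :=
    tendsto_neg_atBot_atTop.comp Real.tendsto_log_nhdsGT_zero
  -- Used here only to see that the divergence is finite, with real value `D`; the choice of `ε` is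
  -- immaterial.
  obtain ⟨D, -, hD0, -, hD, -⟩ := exists_hypLaw_time_le hM PN PA i one_pos
  have key : ∀ ε ∈ Set.Ioo (0 : ℝ) 1,
      misclassExponent Φ PN PA i ≤ ENNReal.ofReal ((D + ε) / (1 - ε) ^ 2) := by
    rintro ε ⟨hε, hε1⟩
    obtain ⟨D', c, hD0', hc, hD', hbound⟩ := exists_hypLaw_time_le hM PN PA i hε
    obtain rfl : D = D' := by
      rwa [hD, ENNReal.ofReal_eq_ofReal_iff hD0 hD0'] at hD'
    -- With this `N`, the change-of-measure term `exp (N * (D + ε)) * β` is at most `β ^ ε`, which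
    -- tends to `0`, while `N` itself tends to infinity.
    set N : ℝ → ℕ := fun β => ⌊-Real.log β * (1 - ε) / (D + ε)⌋₊ with hN
    have h1ε : 0 < 1 - ε := by linarith
    have hDε : 0 < D + ε := by linarith
    have hNt : Tendsto N (𝓝[>] 0) atTop :=
      tendsto_nat_floor_atTop.comp ((hlog.atTop_mul_const h1ε).atTop_div_const hDε)
    have t1 : Tendsto (fun β : ℝ => β) (𝓝[>] 0) (𝓝 0) := nhdsWithin_le_nhds
    have t2 : Tendsto (fun β : ℝ => Real.exp (-(c * (N β : ℝ)))) (𝓝[>] 0) (𝓝 0) :=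
      Real.tendsto_exp_neg_atTop_nhds_zero.comp
        ((tendsto_natCast_atTop_atTop.comp hNt).const_mul_atTop hc)
    have t3 : Tendsto (fun β : ℝ => Real.exp (-(ε * -Real.log β))) (𝓝[>] 0) (𝓝 0) :=
      Real.tendsto_exp_neg_atTop_nhds_zero.comp (hlog.const_mul_atTop hε)
    have t := (t1.add t2).add t3
    simp only [add_zero] at t
    refine liminf_le_of_frequently_le' (Eventually.frequently ?_)
    filter_upwards [t.eventually (ge_mem_nhds hε), Ioo_mem_nhdsGT (zero_lt_one' ℝ)]
      with β hβ hβ01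
    have hL : 0 < -Real.log β := neg_pos.mpr (Real.log_neg hβ01.1 hβ01.2)
    have hfl : (N β : ℝ) ≤ -Real.log β * (1 - ε) / (D + ε) := Nat.floor_le (by positivity)
    have hfl' : -Real.log β * (1 - ε) / (D + ε) ≤ ((N β + 1 : ℕ) : ℝ) := by
      push_cast; exact (Nat.lt_floor_add_one _).le
    have hexp : Real.exp (N β * (D + ε)) * β ≤ Real.exp (-(ε * -Real.log β)) := by
      calc Real.exp (N β * (D + ε)) * β = Real.exp (N β * (D + ε) + Real.log β) := by
            rw [Real.exp_add, Real.exp_log hβ01.1]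
        _ ≤ _ := by
            rw [Real.exp_le_exp]
            rw [le_div_iff₀ hDε] at hfl
            linarith
    have hprob : hypLaw PN PA i {ω | (Φ β).τ ω ≤ N β} ≤ ENNReal.ofReal ε :=
      (hbound (Φ β) β hβ01.1.le (hΦ β hβ01) (N β)).trans
        (ENNReal.ofReal_le_ofReal (by linarith))
    have hE : ENNReal.ofReal (-Real.log β * (1 - ε) / (D + ε) * (1 - ε)) ≤
        expectedTime (Φ β) PN PA i := by
      refine le_trans ?_ (mul_le_expectedTime (Φ β) PN PA i (N β))
      rw [ENNReal.ofReal_mul (by positivity)]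
      refine mul_le_mul' ?_ ?_
      · rw [← ENNReal.ofReal_natCast]
        exact ENNReal.ofReal_le_ofReal hfl'
      · rw [ENNReal.ofReal_sub _ hε.le, ENNReal.ofReal_one]
        exact tsub_le_tsub_left hprob 1
    refine (ENNReal.div_le_div_left hE _).trans (le_of_eq ?_)
    rw [← ENNReal.ofReal_div_of_pos (by positivity)]
    congr 1
    have hL' : Real.log β ≠ 0 := by linarith
    field_simp
  rw [hD]
  have hlim : Tendsto (fun ε : ℝ => ENNReal.ofReal ((D + ε) / (1 - ε) ^ 2)) (𝓝[>] 0)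
      (𝓝 (ENNReal.ofReal D)) := by
    refine ENNReal.tendsto_ofReal ?_
    have : ContinuousAt (fun ε : ℝ => (D + ε) / (1 - ε) ^ 2) 0 := by
      refine ContinuousAt.div (by fun_prop) (by fun_prop) (by norm_num)
    have h := this.tendsto
    simp only [add_zero, sub_zero, one_pow, div_one] at h
    exact h.mono_left nhdsWithin_le_nhds
  refine ge_of_tendsto hlim ?_
  filter_upwards [Ioo_mem_nhdsGT (zero_lt_one' ℝ)] with ε hε using key ε hε

end Converse

/-! ### Empirical distributions and scores -/

section Empirical

/-- Equality fails at `a = 0`, where the quotient is `0`; this happens at symbols that an average of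
types does not charge. -/
theorem mul_div_self_le {a b : ℝ} (hb : 0 ≤ b) : a * (b / a) ≤ b := by
  rcases eq_or_ne a 0 with rfl | h
  · simpa using hb
  · rw [mul_div_cancel₀ _ h]

variable {X : Type*} [MeasurableSpace X] {M : ℕ}

theorem isProbabilityMeasure_empType {k : ℕ} (hk : 1 ≤ k) (x : Fin k → Fin M → X) (j : Fin M) :
    IsProbabilityMeasure (empType x j) := by
  constructor
  simp only [empType, Measure.smul_apply, Measure.finsetSum_apply, measure_univ, Finset.sum_const,
    Finset.card_univ, Fintype.card_fin, smul_eq_mul, nsmul_eq_mul, mul_one]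
  exact ENNReal.inv_mul_cancel (by simp only [ne_eq, Nat.cast_eq_zero]; omega)
    (ENNReal.natCast_ne_top _)

theorem avgLaw_real_pos {P : Fin M → Measure X} [∀ j, IsProbabilityMeasure (P j)] (hM : 2 ≤ M)
    {l j : Fin M} (hj : j ≠ l) {a : X} (h : 0 < (P j).real {a}) : 0 < (avgLaw l P).real {a} := by
  have := isProbabilityMeasure_avgLaw hM l P
  refine ENNReal.toReal_pos (fun h0 => ?_) (measure_ne_top _ _)
  rw [Measure.real, absolutelyContinuous_avgLaw hj P h0] at h
  simp at h

theorem sum_erase_real_eq {P : Fin M → Measure X} [∀ j, IsProbabilityMeasure (P j)] (hM : 2 ≤ M)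
    (l : Fin M) (s : Set X) :
    ∑ j ∈ Finset.univ.erase l, (P j).real s = ((M - 1 : ℕ) : ℝ) * (avgLaw l P).real s := by
  have : ((M - 1 : ℕ) : ℝ) ≠ 0 := by exact_mod_cast (by omega : M - 1 ≠ 0)
  rw [avgLaw_real, mul_inv_cancel_left₀ this]

variable [MeasurableSingletonClass X]

theorem empType_real_pos {k : ℕ} (x : Fin k → Fin M → X) (t : Fin k)
    (j : Fin M) : 0 < (empType x j).real {x t j} := by
  have hk : 1 ≤ k := t.pos
  have := isProbabilityMeasure_empType hk x j
  refine ENNReal.toReal_pos ?_ (measure_ne_top _ _)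
  simp only [empType, Measure.smul_apply, Measure.finsetSum_apply, smul_eq_mul, ne_eq, mul_eq_zero,
    ENNReal.inv_eq_zero, ENNReal.natCast_ne_top, false_or, Finset.sum_eq_zero_iff, not_forall]
  exact ⟨t, Finset.mem_univ t, by simp⟩

open Classical in
theorem empType_real_singleton {k : ℕ} (x : Fin k → Fin M → X) (j : Fin M) (a : X) :
    (empType x j).real {a} = ((Finset.univ.filter fun s => x s j = a).card : ℝ) / k := by
  simp only [empType, Measure.real, Measure.smul_apply, Measure.finsetSum_apply, smul_eq_mul,
    Measure.dirac_apply' _ (measurableSet_singleton a), Set.indicator_apply, mem_singleton_iff,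
    Pi.one_apply, Finset.sum_boole, ENNReal.toReal_mul, ENNReal.toReal_inv, ENNReal.toReal_natCast]
  rw [div_eq_inv_mul]

variable [Fintype X]

theorem integral_empType {k : ℕ} (x : Fin k → Fin M → X) (j : Fin M) (h : X → ℝ) :
    ∫ a, h a ∂(empType x j) = (k : ℝ)⁻¹ * ∑ t, h (x t j) := by
  rw [empType, integral_smul_measure, integral_finsetSum_measure fun t _ => Integrable.of_finite]
  simp [integral_dirac]

theorem sum_eq_mul_sum_empType {k : ℕ} (hk : 1 ≤ k) (x : Fin k → Fin M → X) (j : Fin M)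
    (h : X → ℝ) : ∑ t, h (x t j) = k * ∑ a, (empType x j).real {a} * h a := by
  have := isProbabilityMeasure_empType hk x j
  have hk0 : (k : ℝ) ≠ 0 := by exact_mod_cast (by omega : k ≠ 0)
  have e := integral_empType x j h
  rw [integral_fintype Integrable.of_finite] at e
  simp only [smul_eq_mul] at e
  rw [e, mul_inv_cancel_left₀ hk0]

theorem sum_real_singleton_eq_one (μ : Measure X) [IsProbabilityMeasure μ] :
    ∑ a, μ.real {a} = 1 := by
  simp [sum_measureReal_singleton]

/-- Integrating against a type is averaging over the sample. Nonnegativity is recorded because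
`ENNReal.ofReal` would truncate. -/
theorem score_eq (hM : 2 ≤ M) {k : ℕ} (hk : 1 ≤ k) (l : Fin M) (x : Fin k → Fin M → X) :
    0 ≤ (k : ℝ)⁻¹ * ∑ t, llrSum l (empType x) (x t) ∧
    score l x = ENNReal.ofReal ((k : ℝ)⁻¹ * ∑ t, llrSum l (empType x) (x t)) := by
  have := fun j => isProbabilityMeasure_empType hk x j
  have e : (k : ℝ)⁻¹ * ∑ t, llrSum l (empType x) (x t) =
      ∫ y, llrSum l (empType x) y ∂(Measure.pi (empType x)) := by
    rw [integral_llrSum]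
    simp only [integral_empType, llrSum]
    rw [Finset.sum_comm, Finset.mul_sum]
  rw [e]
  exact ⟨integral_llrSum_nonneg hM l _, G_eq_ofReal_integral hM l _⟩

theorem threshold_lt_score_iff (hM : 2 ≤ M) {k : ℕ} (hk : 1 ≤ k) (l : Fin M)
    (x : Fin k → Fin M → X) (g : ℝ) :
    (g : EReal) < ((score l x : ℝ≥0∞) : EReal) ↔ k * g < ∑ t, llrSum l (empType x) (x t) := by
  obtain ⟨h0, h⟩ := score_eq hM hk l x
  have hk0 : (0 : ℝ) < k := by exact_mod_cast hk
  rw [h, EReal.coe_ennreal_ofReal, max_eq_left h0, EReal.coe_lt_coe_iff, lt_inv_mul_iff₀ hk0]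

/-- The score lies above its tangent plane at any family of fully supported laws. -/
theorem sum_llrSum_le_empType (hM : 2 ≤ M) {k : ℕ} (hk : 1 ≤ k) (l : Fin M)
    (P : Fin M → Measure X) [∀ j, IsProbabilityMeasure (P j)] (hP : ∀ j a, 0 < (P j).real {a})
    (x : Fin k → Fin M → X) :
    ∑ t, llrSum l P (x t) ≤ ∑ t, llrSum l (empType x) (x t) := by
  have := fun j => isProbabilityMeasure_empType hk x j
  have := isProbabilityMeasure_avgLaw hM l (empType x)
  set T := empType x with hT
  set p := avgLaw l P with hp
  set q := avgLaw l T with hq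
  -- The gap to the tangent plane is controlled by `log u ≤ u - 1`. It remains to see that the terms
  -- `u` sum to at most `k * (M - 1)`, the number of ones subtracted.
  have h1 : ∀ t, ∀ j ∈ Finset.univ.erase l,
      Real.log ((P j).real {x t j} / p.real {x t j}) -
        Real.log ((T j).real {x t j} / q.real {x t j}) ≤
      (P j).real {x t j} * q.real {x t j} / (p.real {x t j} * (T j).real {x t j}) - 1 := by
    intro t j hj
    have a1 := hP j (x t j)
    have a2 := empType_real_pos x t j
    have a3 : 0 < p.real {x t j} := avgLaw_real_pos hM (Finset.ne_of_mem_erase hj) a1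
    have a4 : 0 < q.real {x t j} := avgLaw_real_pos hM (Finset.ne_of_mem_erase hj) a2
    rw [← Real.log_div (by positivity) (by positivity), div_div_div_eq]
    exact Real.log_le_sub_one_of_pos (by positivity)
  have h2 : ∀ j ∈ Finset.univ.erase l,
      ∑ t, (P j).real {x t j} * q.real {x t j} / (p.real {x t j} * (T j).real {x t j}) ≤
        k * ∑ a, (P j).real {a} * (q.real {a} / p.real {a}) := by
    intro j hj
    rw [sum_eq_mul_sum_empType hk x j
      fun a => (P j).real {a} * q.real {a} / (p.real {a} * (T j).real {a})]
    refine mul_le_mul_of_nonneg_left (Finset.sum_le_sum fun a _ => ?_) (Nat.cast_nonneg k)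
    rcases (measureReal_nonneg : 0 ≤ (T j).real {a}).eq_or_lt with h | h
    · rw [← hT, ← h, zero_mul]; positivity
    · rw [← hT]
      have a3 : 0 < p.real {a} := avgLaw_real_pos hM (Finset.ne_of_mem_erase hj) (hP j a)
      refine le_of_eq ?_
      field_simp
  -- Summed over `j`, the laws `P j` give `(M - 1) * p`, which cancels the denominator and leaves
  -- the total mass of `q`.
  have h3 : ∑ j ∈ Finset.univ.erase l, (k : ℝ) * ∑ a, (P j).real {a} * (q.real {a} / p.real {a}) ≤
      k * ((M - 1 : ℕ) : ℝ) := by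
    rw [← Finset.mul_sum, Finset.sum_comm]
    gcongr
    calc ∑ a, ∑ j ∈ Finset.univ.erase l, (P j).real {a} * (q.real {a} / p.real {a}) ≤
          ∑ a, ((M - 1 : ℕ) : ℝ) * q.real {a} := by
          refine Finset.sum_le_sum fun a _ => ?_
          rw [← Finset.sum_mul, sum_erase_real_eq hM, mul_assoc]
          gcongr
          exact mul_div_self_le measureReal_nonneg
      _ = _ := by rw [← Finset.mul_sum, sum_real_singleton_eq_one, mul_one]
  have h4 : ∑ t, llrSum l P (x t) - ∑ t, llrSum l T (x t) ≤ 0 := by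
    simp only [llrSum]
    rw [← Finset.sum_sub_distrib]
    simp only [← Finset.sum_sub_distrib]
    refine (Finset.sum_le_sum fun t _ => Finset.sum_le_sum (h1 t)).trans ?_
    simp only [Finset.sum_sub_distrib]
    rw [Finset.sum_comm]
    have := (Finset.sum_le_sum h2).trans h3
    simp only [Finset.sum_const, Finset.card_erase_of_mem (Finset.mem_univ l), Finset.card_univ,
      Fintype.card_fin, nsmul_eq_mul, mul_one]
    linarith
  linarith

/-- The divergences of the types from any law `Q` add up to at least the score. -/
theorem sum_llrSum_empType_le (hM : 2 ≤ M) {k : ℕ} (hk : 1 ≤ k) (l : Fin M)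
    (Q : Measure X) [IsProbabilityMeasure Q] (x : Fin k → Fin M → X)
    (hQ : ∀ t, ∀ j ≠ l, 0 < Q.real {x t j}) :
    ∑ t, llrSum l (empType x) (x t) ≤
      ∑ t, ∑ j ∈ Finset.univ.erase l, Real.log ((empType x j).real {x t j} / Q.real {x t j}) := by
  have := fun j => isProbabilityMeasure_empType hk x j
  have := isProbabilityMeasure_avgLaw hM l (empType x)
  set T := empType x with hT
  set q := avgLaw l T with hq
  -- The types cancel: the full difference is `-k * (M - 1)` times the divergence of `q` from `Q`,
  -- and `log u ≤ u - 1` shows that it is not positive.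
  have h1 : ∀ t, ∀ j ∈ Finset.univ.erase l,
      Real.log ((T j).real {x t j} / q.real {x t j}) -
        Real.log ((T j).real {x t j} / Q.real {x t j}) ≤ Q.real {x t j} / q.real {x t j} - 1 := by
    intro t j hj
    have a1 := hQ t j (Finset.ne_of_mem_erase hj)
    have a2 := empType_real_pos x t j
    have a4 : 0 < q.real {x t j} := avgLaw_real_pos hM (Finset.ne_of_mem_erase hj) a2
    rw [Real.log_div a2.ne' a4.ne', Real.log_div a2.ne' a1.ne', sub_sub_sub_cancel_left,
      ← Real.log_div a1.ne' a4.ne']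
    exact Real.log_le_sub_one_of_pos (by positivity)
  have h3 : ∑ j ∈ Finset.univ.erase l, ∑ t, Q.real {x t j} / q.real {x t j} ≤
      k * ((M - 1 : ℕ) : ℝ) := by
    rw [Finset.sum_congr rfl fun j _ =>
      sum_eq_mul_sum_empType hk x j fun a => Q.real {a} / q.real {a}, ← Finset.mul_sum,
      Finset.sum_comm]
    gcongr
    calc ∑ a, ∑ j ∈ Finset.univ.erase l, (empType x j).real {a} * (Q.real {a} / q.real {a}) ≤
          ∑ a, ((M - 1 : ℕ) : ℝ) * Q.real {a} := by
          refine Finset.sum_le_sum fun a _ => ?_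
          rw [← Finset.sum_mul, sum_erase_real_eq hM, mul_assoc]
          gcongr
          exact mul_div_self_le measureReal_nonneg
      _ = _ := by rw [← Finset.mul_sum, sum_real_singleton_eq_one, mul_one]
  have h4 : ∑ t, llrSum l T (x t) -
      ∑ t, ∑ j ∈ Finset.univ.erase l, Real.log ((T j).real {x t j} / Q.real {x t j}) ≤ 0 := by
    simp only [llrSum]
    rw [← Finset.sum_sub_distrib]
    simp only [← Finset.sum_sub_distrib]
    refine (Finset.sum_le_sum fun t _ => Finset.sum_le_sum (h1 t)).trans ?_
    simp only [Finset.sum_sub_distrib]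
    rw [Finset.sum_comm]
    simp only [Finset.sum_const, Finset.card_erase_of_mem (Finset.mem_univ l), Finset.card_univ,
      Fintype.card_fin, nsmul_eq_mul, mul_one]
    linarith
  linarith

/-- Where the score is large, the likelihood under any law is dominated by that under the types:
`c` is a lower bound for the number of samples times the score. -/
theorem prod_le_of_lt_score (hM : 2 ≤ M) {k : ℕ} (hk : 1 ≤ k) (l : Fin M)
    (Q : Measure X) [IsProbabilityMeasure Q] (x : Fin k → Fin M → X) {c : ℝ}
    (hc : c < ∑ t, llrSum l (empType x) (x t)) :
    ∏ j ∈ Finset.univ.erase l, ∏ t, Q.real {x t j} ≤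
      Real.exp (-c) * ∏ j ∈ Finset.univ.erase l, ∏ t, (empType x j).real {x t j} := by
  by_cases hQ : ∀ t, ∀ j ≠ l, 0 < Q.real {x t j}
  · have h := hc.le.trans (sum_llrSum_empType_le hM hk l Q x hQ)
    rw [← Real.exp_le_exp, Finset.sum_comm, Real.exp_sum] at h
    have e : ∏ j ∈ Finset.univ.erase l,
        Real.exp (∑ t, Real.log ((empType x j).real {x t j} / Q.real {x t j})) =
        (∏ j ∈ Finset.univ.erase l, ∏ t, (empType x j).real {x t j}) /
          ∏ j ∈ Finset.univ.erase l, ∏ t, Q.real {x t j} := by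
      rw [← Finset.prod_div_distrib]
      refine Finset.prod_congr rfl fun j hj => ?_
      rw [Real.exp_sum, ← Finset.prod_div_distrib]
      refine Finset.prod_congr rfl fun t _ => ?_
      have a1 := hQ t j (Finset.ne_of_mem_erase hj)
      have a2 := empType_real_pos x t j
      rw [Real.exp_log (by positivity)]
    have hpos : 0 < ∏ j ∈ Finset.univ.erase l, ∏ t, Q.real {x t j} :=
      Finset.prod_pos fun j hj => Finset.prod_pos fun t _ => hQ t j (Finset.ne_of_mem_erase hj)
    rw [e, le_div_iff₀ hpos] at h
    rw [Real.exp_neg, le_inv_mul_iff₀ (Real.exp_pos _)]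
    exact h
  -- If `Q` misses an observed symbol, the left side vanishes.
  · push Not at hQ
    obtain ⟨t, j, hj, h⟩ := hQ
    have h0 : Q.real {x t j} = 0 := le_antisymm h measureReal_nonneg
    rw [Finset.prod_eq_zero (i := j) (by simp [hj]) (Finset.prod_eq_zero (Finset.mem_univ t) h0)]
    exact mul_nonneg (Real.exp_pos _).le
      (Finset.prod_nonneg fun _ _ => Finset.prod_nonneg fun _ _ => measureReal_nonneg)

end Empirical

/-! ### The error probability of the threshold test -/

section Achievability

variable {X : Type*} [Fintype X]

open Classical in
/-- The likelihoods that the sequences of length `k` have under their own types add up to at most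
the number of types. -/
theorem sum_prod_count_div_le {k : ℕ} (hk : 1 ≤ k) :
    ∑ z : Fin k → X, ∏ t, ((Finset.univ.filter fun s => z s = z t).card : ℝ) / k ≤
      ((k : ℝ) + 1) ^ Fintype.card X := by
  have hk0 : (k : ℝ) ≠ 0 := by exact_mod_cast (by omega : k ≠ 0)
  set cnt : (Fin k → X) → X → Fin (k + 1) := fun z a =>
    ⟨(Finset.univ.filter fun s => z s = a).card, by
      have := Finset.card_filter_le (Finset.univ : Finset (Fin k)) fun s => z s = a
      rw [Finset.card_univ, Fintype.card_fin] at this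
      omega⟩ with hcnt
  -- All sequences with symbol counts `c` share the type `c / k`, so the sum is the probability of
  -- this class under one product law. The number of possible `c` then gives the bound.
  have hfib : ∀ c : X → Fin (k + 1), ∑ z ∈ Finset.univ.filter (fun z => cnt z = c),
      ∏ t, ((Finset.univ.filter fun s => z s = z t).card : ℝ) / k ≤ 1 := by
    intro c
    rcases (Finset.univ.filter fun z => cnt z = c).eq_empty_or_nonempty with h | ⟨z₀, hz₀⟩
    · simp [h]
    have hc : ∑ a, ((c a : ℕ) : ℝ) = k := by
      have h0 : cnt z₀ = c := (Finset.mem_filter.mp hz₀).2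
      have h1 : ∑ a, (Finset.univ.filter fun s => z₀ s = a).card = k := by
        exact (Finset.card_eq_sum_card_fiberwise (f := z₀) (s := Finset.univ) (t := Finset.univ)
          (by simp)).symm.trans (by simp)
      rw [← h0]
      exact_mod_cast h1
    calc ∑ z ∈ Finset.univ.filter (fun z => cnt z = c),
          ∏ t, ((Finset.univ.filter fun s => z s = z t).card : ℝ) / k
        = ∑ z ∈ Finset.univ.filter (fun z => cnt z = c), ∏ t, ((c (z t) : ℕ) : ℝ) / k := by
          refine Finset.sum_congr rfl fun z hz => Finset.prod_congr rfl fun t _ => ?_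
          rw [← (Finset.mem_filter.mp hz).2]
      _ ≤ ∑ z : Fin k → X, ∏ t, ((c (z t) : ℕ) : ℝ) / k :=
          Finset.sum_le_sum_of_subset_of_nonneg (Finset.filter_subset _ _)
            fun _ _ _ => by positivity
      _ = (∑ a, ((c a : ℕ) : ℝ) / k) ^ k := (Fintype.sum_pow (fun a => ((c a : ℕ) : ℝ) / k) k).symm
      _ = 1 := by rw [← Finset.sum_div, hc, div_self hk0, one_pow]
  rw [← Finset.sum_fiberwise _ cnt]
  refine (Finset.sum_le_sum fun c _ => hfib c).trans (le_of_eq ?_)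
  simp

variable {M : ℕ}

theorem sum_prod_comm {k : ℕ} (h : Fin M → (Fin k → X) → ℝ) :
    ∑ y : Fin k → Fin M → X, ∏ j, h j (fun t => y t j) = ∏ j, ∑ z, h j z := by
  classical
  rw [Finset.prod_univ_sum, Fintype.piFinset_univ]
  exact Fintype.sum_equiv (Equiv.piComm _) _ _ fun y => rfl

variable [MeasurableSpace X]

/-- If `i` were outside `Psi` on stopping, the `M - 1` members would be exactly the other indices
and `i` would be declared. Hence `d` plays no role. -/
theorem mem_Psi_of_error (β : ℝ) (d : (k : ℕ) → (Fin k → Fin M → X) → Fin M) (i : Fin M) {k : ℕ}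
    {ω : Path M X} (hτ : epTime β ω = k)
    (hφ : epDecision β d k (samples k ω) ≠ i) : 1 ≤ k ∧ i ∈ Psi β (samples k ω) := by
  obtain ⟨k', hk', h1, hcard⟩ := (epTime_le_iff β ω k).mp hτ.le
  obtain rfl : k' = k := by
    have := (epTime_le_iff β ω k').mpr ⟨k', le_rfl, h1, hcard⟩
    rw [hτ] at this
    exact le_antisymm hk' (by exact_mod_cast this)
  refine ⟨h1, ?_⟩
  by_contra hi
  have hsub : Psi β (samples k' ω) ⊆ Finset.univ.erase i := fun l hl =>
    Finset.mem_erase.mpr ⟨fun h => hi (h ▸ hl), Finset.mem_univ l⟩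
  have heq : Psi β (samples k' ω) = Finset.univ.erase i :=
    Finset.eq_of_subset_of_card_le hsub (by
      rwa [Finset.card_erase_of_mem (Finset.mem_univ i), Finset.card_univ, Fintype.card_fin])
  have hex : ∃ i, Psi β (samples k' ω) = Finset.univ.erase i := ⟨i, heq⟩
  refine hφ ?_
  rw [epDecision, dif_pos hex]
  have h2 := hex.choose_spec
  by_contra hne
  have : i ∈ Finset.univ.erase hex.choose :=
    Finset.mem_erase.mpr ⟨fun h => hne h.symm, Finset.mem_univ _⟩
  exact hi (h2.ge this)

variable [MeasurableSingletonClass X]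

open Classical in
-- After the likelihoods are replaced by those under the types, the score constraint can be dropped
-- and the sum factors over the sequences: the outlier contributes `1`, every other sequence at most
-- the number of types.
theorem sum_prod_seqLaw_le (hM : 2 ≤ M) (PN PA : ProbabilityMeasure X) (i : Fin M) {k : ℕ}
    (hk : 1 ≤ k) (c : ℝ) :
    ∑ y : Fin k → Fin M → X with c < ∑ t, llrSum i (empType y) (y t),
      ∏ j, ∏ t, (seqLaw PN PA i j).real {y t j} ≤
        Real.exp (-c) * ((k : ℝ) + 1) ^ (Fintype.card X * (M - 1)) := by
  obtain ⟨h, hh⟩ : ∃ h : Fin M → (Fin k → X) → ℝ, ∀ j z, h j z =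
    if j = i then ∏ t, (PA : Measure X).real {z t}
    else ∏ t, ((Finset.univ.filter fun s => z s = z t).card : ℝ) / k := ⟨_, fun _ _ => rfl⟩
  have hi : ∀ z, h i z = ∏ t, (PA : Measure X).real {z t} := fun z => by rw [hh, if_pos rfl]
  have hj : ∀ j ∈ Finset.univ.erase i, ∀ z,
      h j z = ∏ t, ((Finset.univ.filter fun s => z s = z t).card : ℝ) / k := fun j hj z => by
    rw [hh, if_neg (Finset.ne_of_mem_erase hj)]
  have hnn : ∀ j z, 0 ≤ h j z := by
    intro j z
    rw [hh]
    split_ifs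
    · exact Finset.prod_nonneg fun t _ => measureReal_nonneg
    · exact Finset.prod_nonneg fun t _ => div_nonneg (Nat.cast_nonneg _) (Nat.cast_nonneg _)
  clear hh
  have hterm : ∀ y : Fin k → Fin M → X, c < ∑ t, llrSum i (empType y) (y t) →
      ∏ j, ∏ t, (seqLaw PN PA i j).real {y t j} ≤
        Real.exp (-c) * ∏ j, h j (fun t => y t j) := by
    intro y hy
    have key := prod_le_of_lt_score hM hk i (PN : Measure X) y hy
    have e1 : ∀ t, (seqLaw PN PA i i).real {y t i} = (PA : Measure X).real {y t i} := by
      intro t; rw [seqLaw, if_pos rfl]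
    have e2 : ∀ j ∈ Finset.univ.erase i, ∏ t, (seqLaw PN PA i j).real {y t j} =
        ∏ t, (PN : Measure X).real {y t j} := by
      intro j hj; rw [seqLaw, if_neg (Finset.ne_of_mem_erase hj)]
    have e3 : ∀ j ∈ Finset.univ.erase i, h j (fun t => y t j) =
        ∏ t, (empType y j).real {y t j} := by
      intro j hj'
      rw [hj j hj']
      exact Finset.prod_congr rfl fun t _ => (empType_real_singleton y j (y t j)).symm
    rw [← Finset.mul_prod_erase _ _ (Finset.mem_univ i),
      ← Finset.mul_prod_erase _ (fun j => h j fun t => y t j) (Finset.mem_univ i),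
      mul_left_comm, Finset.prod_congr rfl e2, Finset.prod_congr rfl e3, hi,
      Finset.prod_congr rfl fun t _ => e1 t]
    exact mul_le_mul_of_nonneg_left key (Finset.prod_nonneg fun t _ => measureReal_nonneg)
  have hprod : ∏ j, ∑ z, h j z ≤ ((k : ℝ) + 1) ^ (Fintype.card X * (M - 1)) := by
    have hi1 : ∑ z, h i z = 1 := by
      simp only [hi]
      rw [← Fintype.sum_pow (fun a => (PA : Measure X).real {a}) k,
        sum_real_singleton_eq_one, one_pow]
    rw [← Finset.mul_prod_erase _ _ (Finset.mem_univ i), hi1, one_mul, pow_mul]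
    refine (Finset.prod_le_prod (g := fun _ => ((k : ℝ) + 1) ^ Fintype.card X)
      (fun j _ => Finset.sum_nonneg fun z _ => hnn _ _) fun j hj' => ?_).trans (le_of_eq ?_)
    · rw [Finset.sum_congr rfl fun z _ => hj j hj' z]
      exact sum_prod_count_div_le hk
    · rw [Finset.prod_const, Finset.card_erase_of_mem (Finset.mem_univ i), Finset.card_univ,
        Fintype.card_fin]
  refine (Finset.sum_le_sum fun y hy => hterm y (Finset.mem_filter.mp hy).2).trans ?_
  refine (Finset.sum_le_sum_of_subset_of_nonneg (Finset.subset_univ _) fun y _ _ =>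
    mul_nonneg (Real.exp_pos _).le (Finset.prod_nonneg fun j _ => hnn _ _)).trans ?_
  rw [← Finset.mul_sum, sum_prod_comm]
  exact mul_le_mul_of_nonneg_left hprod (Real.exp_pos _).le

theorem hypLaw_lt_score_le (hM : 2 ≤ M) (PN PA : ProbabilityMeasure X) (i : Fin M) {k : ℕ}
    (hk : 1 ≤ k) (c : ℝ) :
    hypLaw PN PA i (samples k ⁻¹' {y | c < ∑ t, llrSum i (empType y) (y t)}) ≤
      ENNReal.ofReal (Real.exp (-c) * ((k : ℝ) + 1) ^ (Fintype.card X * (M - 1))) := by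
  classical
  have e1 : {y : Fin k → Fin M → X | c < ∑ t, llrSum i (empType y) (y t)} =
      ((Finset.univ.filter fun y => c < ∑ t, llrSum i (empType y) (y t) :
        Finset (Fin k → Fin M → X)) : Set (Fin k → Fin M → X)) := by simp
  have e2 : ∀ y : Fin k → Fin M → X, ∏ t, Measure.pi (seqLaw PN PA i) {y t} =
      ENNReal.ofReal (∏ j, ∏ t, (seqLaw PN PA i j).real {y t j}) := by
    intro y
    rw [Finset.prod_comm, ENNReal.ofReal_prod_of_nonneg fun t _ =>
      Finset.prod_nonneg fun j _ => measureReal_nonneg]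
    refine Finset.prod_congr rfl fun t _ => ?_
    rw [Measure.pi_singleton, ENNReal.ofReal_prod_of_nonneg fun j _ => measureReal_nonneg]
    simp
  rw [hypLaw_eq, e1, infinitePi_samples_preimage, Finset.sum_congr rfl fun y _ => e2 y,
    ← ENNReal.ofReal_sum_of_nonneg fun y _ =>
      Finset.prod_nonneg fun j _ => Finset.prod_nonneg fun t _ => measureReal_nonneg]
  refine ENNReal.ofReal_le_ofReal ?_
  convert sum_prod_seqLaw_le hM PN PA i hk c

theorem mem_Psi_iff (hM : 2 ≤ M) {k : ℕ} (hk : 1 ≤ k) (β : ℝ) (l : Fin M)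
    (x : Fin k → Fin M → X) :
    l ∈ Psi β x ↔
      k * threshold M (Fintype.card X) β k < ∑ t, llrSum l (empType x) (x t) := by
  simp only [Psi, Finset.mem_filter, Finset.mem_univ, true_and]
  exact threshold_lt_score_iff hM hk l x _

theorem exp_threshold_mul_le {A : ℕ} (hA : 2 ≤ A) (hM : 2 ≤ M) {β : ℝ} (hβ : 0 < β) {k : ℕ}
    (hk : 1 ≤ k) :
    Real.exp (-(k * threshold M A β k)) * ((k : ℝ) + 1) ^ (A * (M - 1)) ≤
      β * (1 / (k * (k + 1))) := by
  have hk0 : (0 : ℝ) < k := by exact_mod_cast hk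
  have hA1 : (0 : ℝ) < (A : ℝ) - 1 := by
    have : (2 : ℝ) ≤ A := by exact_mod_cast hA
    linarith
  have e1 : -(k * threshold M A β k) =
      Real.log (β * ((A : ℝ) - 1)) - ((A * (M + 1) : ℕ) : ℝ) * Real.log ((k : ℝ) + 1) := by
    rw [threshold]
    push_cast
    field_simp
    ring
  -- How the exponent in the threshold is spent: `A * (M - 1)` on the types, `2 * (A - 1)` on the
  -- factor `A - 1`, and the last `2` on summability over `k`.
  have e2 : A * (M + 1) = A * (M - 1) + (2 * (A - 1) + 2) := by
    obtain ⟨m, rfl⟩ : ∃ m, M = m + 1 := ⟨M - 1, by omega⟩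
    obtain ⟨a, rfl⟩ : ∃ a, A = a + 1 := ⟨A - 1, by omega⟩
    simp only [Nat.add_sub_cancel]
    ring
  have e3 : (A : ℝ) - 1 ≤ ((k : ℝ) + 1) ^ (2 * (A - 1)) := by
    have h1 : A - 1 ≤ 2 ^ (A - 1) := Nat.lt_two_pow_self.le
    have h2 : (2 : ℝ) ^ (A - 1) ≤ ((k : ℝ) + 1) ^ (2 * (A - 1)) := by
      have hk1 : (1 : ℝ) ≤ k := by exact_mod_cast hk
      refine (pow_le_pow_left₀ (by norm_num) (by linarith : (2 : ℝ) ≤ k + 1) _).trans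
        (pow_le_pow_right₀ (by linarith) (by omega))
    calc (A : ℝ) - 1 = ((A - 1 : ℕ) : ℝ) := by rw [Nat.cast_sub (by omega)]; simp
      _ ≤ 2 ^ (A - 1) := by exact_mod_cast h1
      _ ≤ _ := h2
  have hpos : (0 : ℝ) < (k : ℝ) + 1 := by positivity
  rw [e1, Real.exp_sub, Real.exp_log (by positivity), ← Real.log_pow,
    Real.exp_log (by positivity), e2, pow_add]
  have e4 : β * ((A : ℝ) - 1) / (((k : ℝ) + 1) ^ (A * (M - 1)) * ((k : ℝ) + 1) ^ (2 * (A - 1) + 2)) *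
      ((k : ℝ) + 1) ^ (A * (M - 1)) =
      β * (((A : ℝ) - 1) / (((k : ℝ) + 1) ^ (2 * (A - 1)) * ((k : ℝ) + 1) ^ 2)) := by
    rw [pow_add _ (2 * (A - 1))]
    field_simp
  rw [e4]
  refine mul_le_mul_of_nonneg_left ?_ hβ.le
  rw [div_le_div_iff₀ (by positivity) (by positivity), one_mul]
  exact mul_le_mul e3 (by nlinarith) (by positivity) (by positivity)

theorem tsum_ofReal_one_div_le : ∑' m : ℕ,
    ENNReal.ofReal (1 / (((m + 1 : ℕ) : ℝ) * (((m + 1 : ℕ) : ℝ) + 1))) ≤ 1 := by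
  refine ENNReal.tsum_le_of_sum_range_le fun n => ?_
  rw [← ENNReal.ofReal_sum_of_nonneg fun _ _ => by positivity]
  rw [← ENNReal.ofReal_one]
  refine ENNReal.ofReal_le_ofReal ?_
  have : ∑ m ∈ Finset.range n, 1 / (((m + 1 : ℕ) : ℝ) * (((m + 1 : ℕ) : ℝ) + 1)) =
      1 - 1 / ((n : ℝ) + 1) := by
    induction n with
    | zero => simp
    | succ n ih =>
      rw [Finset.sum_range_succ, ih]
      push_cast
      field_simp
      ring
  rw [this]
  have : (0 : ℝ) < 1 / ((n : ℝ) + 1) := by positivity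
  linarith

theorem errorProbConstraint_epTest (hX : 2 ≤ Fintype.card X) (hM : 2 ≤ M) {β : ℝ} (hβ : 0 < β)
    (d : (k : ℕ) → (Fin k → Fin M → X) → Fin M) : ErrorProbConstraint (epTest β d) β := by
  intro PN PA i
  set c : ℕ → ℝ := fun k => k * threshold M (Fintype.card X) β k with hc
  have hsub : {ω | ∃ k : ℕ, (epTest β d).τ ω = k ∧ (epTest β d).φ k (samples k ω) ≠ i} ⊆
      ⋃ m : ℕ, samples (m + 1) ⁻¹' {y | c (m + 1) < ∑ t, llrSum i (empType y) (y t)} := by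
    rintro ω ⟨k, hτ, hφ⟩
    obtain ⟨hk, hi⟩ := mem_Psi_of_error β d i hτ hφ
    rw [mem_Psi_iff hM hk] at hi
    obtain ⟨m, rfl⟩ : ∃ m, k = m + 1 := ⟨k - 1, by omega⟩
    exact mem_iUnion.mpr ⟨m, hi⟩
  refine (measure_mono hsub).trans ((measure_iUnion_le _).trans ?_)
  calc _ ≤ ∑' m : ℕ, ENNReal.ofReal β *
        ENNReal.ofReal (1 / (((m + 1 : ℕ) : ℝ) * (((m + 1 : ℕ) : ℝ) + 1))) := by
        refine ENNReal.tsum_le_tsum fun m => ?_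
        rw [← ENNReal.ofReal_mul hβ.le]
        exact (hypLaw_lt_score_le hM PN PA i (by omega) _).trans
          (ENNReal.ofReal_le_ofReal (exp_threshold_mul_le hX hM hβ (by omega)))
    _ ≤ ENNReal.ofReal β := by
        rw [ENNReal.tsum_mul_left]
        exact mul_le_of_le_one_right' tsum_ofReal_one_div_le

end Achievability

/-! ### The expected stopping time of the threshold test -/

section ExpectedTime

theorem eventually_const_mul_log_le (C : ℝ) {ε : ℝ} (hε : 0 < ε) :
    ∀ᶠ k : ℕ in atTop, C * Real.log ((k : ℝ) + 1) ≤ k * ε := by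
  have h := ((Real.isLittleO_log_id_atTop.const_mul_left C).bound (half_pos hε))
  have ht : Tendsto (fun k : ℕ => (k : ℝ) + 1) atTop atTop :=
    tendsto_atTop_add_const_right _ _ tendsto_natCast_atTop_atTop
  filter_upwards [ht.eventually h, eventually_ge_atTop 1] with k hk hk1
  have hk1' : (1 : ℝ) ≤ k := by exact_mod_cast hk1
  rw [id, Real.norm_of_nonneg (by positivity : (0 : ℝ) ≤ (k : ℝ) + 1)] at hk
  have := (le_abs_self _).trans hk
  nlinarith

/-- Since `A ≥ 2`, the term `-log (A - 1)` is not positive and can be dropped. -/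
theorem natCast_mul_threshold_le {M A : ℕ} (hA : 2 ≤ A) {β a ε : ℝ} (hβ : 0 < β) {k : ℕ}
    (hk : 1 ≤ k) (h1 : -Real.log β ≤ k * a)
    (h2 : ((M : ℝ) + 1) * A * Real.log ((k : ℝ) + 1) ≤ k * ε) :
    k * threshold M (A) β k ≤ k * (a + ε) := by
  have hk0 : (k : ℝ) ≠ 0 := by exact_mod_cast (by omega : k ≠ 0)
  have hA' : (2 : ℝ) ≤ A := by exact_mod_cast hA
  have h3 : 0 ≤ Real.log ((A : ℝ) - 1) := Real.log_nonneg (by linarith)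
  rw [threshold, mul_add, mul_div_cancel₀ _ hk0, mul_div_cancel₀ _ hk0,
    Real.log_mul hβ.ne' (by linarith)]
  linarith

variable {X : Type*} [MeasurableSpace X] {M : ℕ}

theorem epTime_le_of_forall_mem [Fintype X] (β : ℝ) (ω : Path M X) (i : Fin M) {k : ℕ}
    (hk : 1 ≤ k) (h : ∀ l ≠ i, l ∈ Psi β (samples k ω)) : epTime β ω ≤ k := by
  refine (epTime_le_iff β ω k).mpr ⟨k, le_rfl, hk, ?_⟩
  have hsub : Finset.univ.erase i ⊆ Psi β (samples k ω) := fun l hl =>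
    h l (Finset.ne_of_mem_erase hl)
  have := Finset.card_le_card hsub
  rwa [Finset.card_erase_of_mem (Finset.mem_univ i), Finset.card_univ, Fintype.card_fin] at this

/-- `τ` is the number of `k < τ`: those below `K` count at most `K`, and each later one is charged
to `u k`. An infinite `τ` makes the sum infinite. -/
theorem toENNReal_le_add_tsum (τ : ℕ∞) (K : ℕ) (u : ℕ → ℝ≥0∞)
    (hu : ∀ k, K ≤ k → (k : ℕ∞) < τ → 1 ≤ u k) : (τ : ℝ≥0∞) ≤ K + ∑' k, u k := by
  have hfin : ∀ n : ℕ, (n : ℕ∞) ≤ τ → (n : ℝ≥0∞) ≤ K + ∑' k, u k := by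
    intro n hn
    rcases le_total n K with h | h
    · exact le_add_right (by exact_mod_cast h)
    · calc (n : ℝ≥0∞) = K + ∑ k ∈ Finset.Ico K n, 1 := by
            rw [Finset.sum_const, Nat.card_Ico, nsmul_eq_mul, mul_one]
            exact_mod_cast (Nat.add_sub_cancel' h).symm
        _ ≤ K + ∑ k ∈ Finset.Ico K n, u k := by
            gcongr with k hk
            obtain ⟨h1, h2⟩ := Finset.mem_Ico.mp hk
            exact hu k h1 (lt_of_lt_of_le (by exact_mod_cast h2) hn)
        _ ≤ _ := by gcongr; exact ENNReal.sum_le_tsum _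
  rcases eq_or_ne τ ⊤ with rfl | hτ
  · rw [ENat.toENNReal_top]
    exact le_of_tendsto' ENNReal.tendsto_nat_nhds_top fun n => hfin n le_top
  · obtain ⟨n, rfl⟩ := ENat.ne_top_iff_exists.mp hτ
    rw [ENat.toENNReal_coe]
    exact hfin n le_rfl

variable [Fintype X] [MeasurableSingletonClass X]

/-- Past the deterministic time `K`, continuing at `k` requires some tangent plane to fall below its
mean by `ε`. These bad events do not involve `β`, and their probabilities are summable. -/
theorem exists_expectedTime_epTest_le (hX : 2 ≤ Fintype.card X) (hM : 2 ≤ M)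
    (PN PA : ProbabilityMeasure X) (hPN : ∀ x, 0 < (PN : Measure X) {x})
    (hPA : ∀ x, 0 < (PA : Measure X) {x}) (i : Fin M) {D a : ℝ} (hD : 0 ≤ D)
    (hGJS : GJS (PN : Measure X) (PA : Measure X) ((M - 2 : ℕ) : ℝ≥0∞) = ENNReal.ofReal D)
    (ha : 0 < a) (haD : a < D) :
    ∃ C : ℝ, 0 ≤ C ∧ ∀ β ∈ Set.Ioo (0 : ℝ) 1, ∀ d : (k : ℕ) → (Fin k → Fin M → X) → Fin M,
      expectedTime (epTest β d) PN PA i ≤ ENNReal.ofReal (-Real.log β / a + C) := by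
  set P := seqLaw PN PA i with hP
  -- Chosen so that `a + ε = D - ε`: the bound on the threshold meets the bound on the empirical
  -- mean.
  set ε : ℝ := (D - a) / 2 with hε
  have hε0 : 0 < ε := by rw [hε]; linarith
  have hfull : ∀ j x, 0 < (P j).real {x} := by
    intro j x
    refine ENNReal.toReal_pos ?_ (measure_ne_top _ _)
    rw [hP, seqLaw]
    split_ifs
    · exact (hPA x).ne'
    · exact (hPN x).ne'
  have hmean : ∀ l ≠ i, ∫ y, llrSum l P y ∂(Measure.pi P) = D := by
    intro l hl
    have := G_eq_ofReal_integral hM l P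
    rw [hP, G_seqLaw hM PN PA hl, hGJS,
      ENNReal.ofReal_eq_ofReal_iff hD (integral_llrSum_nonneg hM l _)] at this
    exact this.symm
  set bad : ℕ → Set (Path M X) := fun k => samples k ⁻¹'
    {y | ∃ l ≠ i, ∑ t, llrSum l P (y t) ≤ k * (D - ε)} with hbad
  have hbadm : ∀ k, MeasurableSet (bad k) := fun k =>
    measurable_samples k (Set.toFinite _).measurableSet
  choose! c hc0 hc using fun l : Fin M =>
    exists_infinitePi_sum_le (Measure.pi P) (llrSum l P) hε0
  have hprob : ∀ k, hypLaw PN PA i (bad k) ≤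
      ∑ l, ENNReal.ofReal (Real.exp (-(c l * k))) := by
    intro k
    have hsub : bad k ⊆ ⋃ l ∈ Finset.univ.erase i, {ω | ∑ t : Fin k, llrSum l P (ω t) ≤
        k * (∫ y, llrSum l P y ∂(Measure.pi P) - ε)} := by
      rintro ω ⟨l, hl, h⟩
      refine mem_iUnion₂.mpr ⟨l, Finset.mem_erase.mpr ⟨hl, Finset.mem_univ l⟩, ?_⟩
      rw [mem_ofPred_eq, hmean l hl]
      exact h
    refine (measure_mono hsub).trans ((measure_biUnion_finset_le _ _).trans ?_)
    exact (Finset.sum_le_sum fun l _ => hc l k).trans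
      (Finset.sum_le_sum_of_subset (Finset.subset_univ _))
  have hsum : ∑' k, hypLaw PN PA i (bad k) ≠ ⊤ := by
    refine ne_top_of_le_ne_top ?_ (ENNReal.tsum_le_tsum hprob)
    rw [Summable.tsum_finsetSum fun _ _ => ENNReal.summable]
    refine ENNReal.sum_ne_top.mpr fun l _ => ?_
    have hs : Summable fun k : ℕ => Real.exp (-(c l * k)) := by
      have := Real.summable_exp_nat_mul_iff.mpr (neg_neg_of_pos (hc0 l))
      refine this.congr fun k => ?_
      congr 1; ring
    exact hs.tsum_ofReal_ne_top
  -- From `K0` on, the logarithmic term of the threshold is at most `ε`.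
  obtain ⟨K0, hK0⟩ := eventually_atTop.mp
    ((eventually_const_mul_log_le (((M : ℝ) + 1) * Fintype.card X) hε0).and (eventually_ge_atTop 1))
  refine ⟨K0 + 1 + (∑' k, hypLaw PN PA i (bad k)).toReal, by positivity, fun β hβ d => ?_⟩
  have hL : 0 < -Real.log β := neg_pos.mpr (Real.log_neg hβ.1 hβ.2)
  set K : ℕ := max K0 ⌈-Real.log β / a⌉₊ with hK
  have hstep : ∀ ω, ((epTest β d).τ ω : ℝ≥0∞) ≤
      K + ∑' k, (bad k).indicator (fun _ => (1 : ℝ≥0∞)) ω := by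
    intro ω
    refine toENNReal_le_add_tsum _ K _ fun k hk hkτ => ?_
    by_contra hlt
    have hω : ω ∉ bad k := fun h => hlt (by rw [Set.indicator_of_mem h])
    obtain ⟨hlogk, hk1⟩ := hK0 k ((le_max_left _ _).trans hk)
    refine absurd hkτ (not_lt.mpr (epTime_le_of_forall_mem β ω i hk1 fun l hl => ?_))
    rw [mem_Psi_iff hM hk1]
    have h1 : (k : ℝ) * (D - ε) < ∑ t, llrSum l P (samples k ω t) := by
      by_contra h
      exact hω ⟨l, hl, not_lt.mp h⟩
    have h2 := sum_llrSum_le_empType hM hk1 l P hfull (samples k ω)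
    have h3 : -Real.log β ≤ k * a := by
      rw [← div_le_iff₀ ha]
      refine (Nat.le_ceil _).trans ?_
      exact_mod_cast (le_max_right _ _).trans hk
    have h4 := natCast_mul_threshold_le hX hβ.1 hk1 h3 hlogk
    have h5 : a + ε = D - ε := by rw [hε]; ring
    rw [h5] at h4
    linarith
  have hKle : (K : ℝ) ≤ -Real.log β / a + (K0 + 1) := by
    have h1 := (Nat.ceil_lt_add_one (div_pos hL ha).le).le
    have h2 : 0 < -Real.log β / a := div_pos hL ha
    have h3 : (0 : ℝ) ≤ K0 := Nat.cast_nonneg _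
    rw [hK, Nat.cast_max]
    exact max_le (by linarith) (by linarith)
  calc expectedTime (epTest β d) PN PA i
      ≤ ∫⁻ ω, (K + ∑' k, (bad k).indicator (fun _ => (1 : ℝ≥0∞)) ω) ∂(hypLaw PN PA i) :=
        lintegral_mono hstep
    _ = K + ∑' k, hypLaw PN PA i (bad k) := by
        rw [lintegral_add_left measurable_const, lintegral_const, measure_univ, mul_one,
          lintegral_tsum fun k => (measurable_const.indicator (hbadm k)).aemeasurable]
        simp only [lintegral_indicator_const (hbadm _), one_mul]
    _ = ENNReal.ofReal (K + (∑' k, hypLaw PN PA i (bad k)).toReal) := by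
        rw [ENNReal.ofReal_add (Nat.cast_nonneg _) ENNReal.toReal_nonneg, ENNReal.ofReal_natCast,
          ENNReal.ofReal_toReal hsum]
    _ ≤ _ := ENNReal.ofReal_le_ofReal (by linarith)

/-- For each `a < D` the additive constant in the expected time is negligible against `-log β`, so
the exponent is at least `a`; then `a` increases to `D`. -/
theorem GJS_le_misclassExponent_epTest (hX : 2 ≤ Fintype.card X) (hM : 2 ≤ M)
    (d : ℝ → (k : ℕ) → (Fin k → Fin M → X) → Fin M)
    (PN PA : ProbabilityMeasure X) (hPN : ∀ x, 0 < (PN : Measure X) {x})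
    (hPA : ∀ x, 0 < (PA : Measure X) {x}) (i : Fin M) :
    GJS (PN : Measure X) (PA : Measure X) ((M - 2 : ℕ) : ℝ≥0∞) ≤
      misclassExponent (fun β => epTest β (d β)) PN PA i := by
  have hlog : Tendsto (fun β : ℝ => -Real.log β) (𝓝[>] 0) atTop :=
    tendsto_neg_atBot_atTop.comp Real.tendsto_log_nhdsGT_zero
  obtain ⟨D, -, hD0, -, hD, -⟩ := exists_hypLaw_time_le hM PN PA i one_pos
  rw [hD]
  rcases hD0.eq_or_lt with rfl | hDpos
  · simp
  have key : ∀ a ∈ Set.Ioo 0 D,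
      ENNReal.ofReal a ≤ misclassExponent (fun β => epTest β (d β)) PN PA i := by
    rintro a ⟨ha, haD⟩
    obtain ⟨C, hC, hbound⟩ := exists_expectedTime_epTest_le hX hM PN PA hPN hPA i hD0 hD ha haD
    have hlim : Tendsto (fun β : ℝ => ENNReal.ofReal ((a⁻¹ + C / -Real.log β)⁻¹)) (𝓝[>] 0)
        (𝓝 (ENNReal.ofReal a)) := by
      refine ENNReal.tendsto_ofReal ?_
      have h := ((hlog.const_div_atTop C).const_add a⁻¹).inv₀ (by simp [ha.ne'])
      simpa using h
    rw [← hlim.liminf_eq]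
    refine liminf_le_liminf ?_
    filter_upwards [Ioo_mem_nhdsGT (zero_lt_one' ℝ)] with β hβ
    have hL : 0 < -Real.log β := neg_pos.mpr (Real.log_neg hβ.1 hβ.2)
    refine le_trans (le_of_eq ?_) (ENNReal.div_le_div_left (hbound β hβ (d β)) _)
    rw [← ENNReal.ofReal_div_of_pos (by positivity)]
    congr 1
    generalize -Real.log β = L at hL
    field_simp
  refine le_of_tendsto (x := 𝓝[<] D) (ENNReal.tendsto_ofReal nhdsWithin_le_nhds) ?_
  filter_upwards [Ioo_mem_nhdsLT hDpos] with a ha using key a ha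

end ExpectedTime

end OutlierTest

theorem theorem2 {X : Type*} [Fintype X] [MeasurableSpace X] [MeasurableSingletonClass X]
    (hX : 2 ≤ Fintype.card X) (M : ℕ) (hM : 2 ≤ M) :
    -- the threshold test, with any choice of the decision where its rule leaves it open
    (∀ d : ℝ → (k : ℕ) → (Fin k → Fin M → X) → Fin M,
      -- meets the constraint at every level
      (∀ β ∈ Set.Ioo (0 : ℝ) 1, ErrorProbConstraint (epTest β (d β)) β) ∧
      ∀ PN PA : ProbabilityMeasure X,
        (∀ x, 0 < (PN : Measure X) {x}) → (∀ x, 0 < (PA : Measure X) {x}) → ∀ i : Fin M,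
          -- achieves the divergence
          GJS (PN : Measure X) (PA : Measure X) ((M - 2 : ℕ) : ℝ≥0∞) ≤
            misclassExponent (fun β => epTest β (d β)) PN PA i ∧
          -- and hence has exactly this exponent
          misclassExponent (fun β => epTest β (d β)) PN PA i =
            GJS (PN : Measure X) (PA : Measure X) ((M - 2 : ℕ) : ℝ≥0∞)) ∧
    -- no family of tests that meets the constraint has a larger exponent
    ∀ Φ : ℝ → SeqTest M X, (∀ β ∈ Set.Ioo (0 : ℝ) 1, ErrorProbConstraint (Φ β) β) →
      ∀ (PN PA : ProbabilityMeasure X) (i : Fin M),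
        misclassExponent Φ PN PA i ≤ GJS (PN : Measure X) (PA : Measure X) ((M - 2 : ℕ) : ℝ≥0∞) := by
  refine ⟨fun d => ⟨fun β hβ => errorProbConstraint_epTest hX hM hβ.1 (d β),
    fun PN PA hPN hPA i => ?_⟩, fun Φ hΦ PN PA i => misclassExponent_le hM Φ hΦ PN PA i⟩
  have h := GJS_le_misclassExponent_epTest hX hM d PN PA hPN hPA i
  exact ⟨h, le_antisymm (misclassExponent_le hM _
    (fun β hβ => errorProbConstraint_epTest hX hM hβ.1 (d β)) PN PA i) h⟩
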